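/- For $z\in\mathbb C\setminus[0,\infty)$, $s\in\mathbb C$, and $a\in\mathbb C$ such that no integer lies on the half-line from $-a$ to $-a-i\infty$ (i.e. $\Im a>0$ or $\Re a\notin\mathbb Z$), let $$B(z,s,a)=\frac1{2\pi i}\int_{-i\infty}^{(-a+)}\frac{\Gamma(1+t)\Gamma(-t)(-z)^t}{(a+t)^s}\,dt ,$$ where $(-z)^t=e^{t\ln(-z)}$ with the principal logarithm, and the contour comes from $-i\infty$ along the half-line below $-a$, circles $t=-a$ once in the positive direction on a circle $|t+a|=\rho$ whose closed disc contains no integer, and returns to $-i\infty$ along the same half-line, $\arg(a+t)$ increasing from $-\pi/2$ to $3\pi/2$. For $\Re x>0$ and $n=0,1,2,\ldots$ let $$p_n(x,s)=\int_{\infty}^{(0+)}e^{-x\tau}\tau^{-s}\left(1-e^{-\tau}\right)^n\,d\tau ,$$ where the contour comes from $+\infty$ along the positive real axis, circles $\tau=0$ once in the positive direction on a circle $|\tau|=\delta$, $\delta>0$, and returns to $+\infty$, $\arg\tau$ increasing from $0$ to $2\pi$. These integrals converge absolutely, and the following holds (for every admissible $\rho$ and every $\delta>0$). (1) If $|e^{2\pi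 ia}|\le|e^{2\pi ia}-1|$ (for real $a\in(0,1)$ this means $\frac16\le a\le\frac56$), or if $s$ is an integer, then, with $x=\frac12-\frac{\ln(-z)}{2\pi i}$ (so that $0<\Re x<1$), $$B(z,s,a)=\frac{e^{\pi ia}(2\pi i)^{s-1}}{(-z)^a}\sum_{n=0}^\infty\frac{e^{2\pi ian}}{\left(e^{2\pi ia}-1\right)^{n+1}}\,p_n(x,s),$$ the series being convergent (in the sense of its partial sums); powers have their principal values. (2) For all $n\ge0$ and $\Re x>0$, $$p_n(x,s)=\frac{-2\pi i\,e^{-\pi is}}{\Gamma(s)}\sum_{m=0}^n\binom nm(-1)^m(x+m)^{s-1},$$ where $1/\Gamma(s)=0$ if $s$ is a non-positive integer. (3) For each fixed $n\ge0$ and each $s\notin\{n+1,n+2,\ldots\}$, $$p_n(x,s)\sim\left(e^{-2\pi is}-1\right)\Gamma(n-s+1)\,x^{s-n-1}$$ as $|x|\to\infty$ in the half-plane $\Re x>0$. (If $s$ is an integer $\le n$, both sides vanish identically.) -/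

import Mathlib

open Complex Filter Topology Asymptotics

noncomputable section

namespace Lerch

/-- The power `u ^ w` at the point `u = r * e ^ (i θ)` of the Riemann surface of the logarithm,
i.e. with `arg u = θ` (not reduced modulo `2π`). -/
def branchPow (r θ : ℝ) (w : ℂ) : ℂ :=
  exp (w * (Real.log r + θ * I))

/-- Convergence of the two improper integrals in `loopIntegral`. -/
def LoopIntegrable (F : ℝ → ℝ → ℂ) (θ₀ ρ : ℝ) : Prop :=
  MeasureTheory.IntegrableOn (fun r : ℝ => F r θ₀) (Set.Ioi ρ) ∧
  MeasureTheory.IntegrableOn (fun r : ℝ => F r (θ₀ + 2 * Real.pi)) (Set.Ioi ρ)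

/-- The integral `∫ F du` over the loop that comes in from infinity along the ray `arg u = θ₀` up
to `|u| = ρ`, runs once counterclockwise round the circle `|u| = ρ`, and returns to infinity
along the same ray, where now `arg u = θ₀ + 2π`. Here `F r θ` is the value of the (possibly
multivalued) integrand at the point `u = r * e ^ (i θ)` of the Riemann surface of the logarithm. -/
def loopIntegral (F : ℝ → ℝ → ℂ) (θ₀ ρ : ℝ) : ℂ :=
  -(∫ r in Set.Ioi ρ, F r θ₀ * exp (θ₀ * I))
    + (∫ θ in θ₀..(θ₀ + 2 * Real.pi), F ρ θ * (I * (ρ * exp (θ * I))))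
    + ∫ r in Set.Ioi ρ, F r (θ₀ + 2 * Real.pi) * exp (((θ₀ + 2 * Real.pi : ℝ) : ℂ) * I)

/-- `Γ(1+t) Γ(-t) (-z)^t / (a+t)^s` at `t = -a + r e^{iθ}`, where `arg (a + t) = θ` and `(-z)^t` has
its principal value. -/
def branchIntegrand (z s a : ℂ) (r θ : ℝ) : ℂ :=
  let t : ℂ := -a + r * exp (θ * I)
  Gamma (1 + t) * Gamma (-t) * (-z) ^ t / branchPow r θ s

/-- The branch-point contribution
`B(z,s,a) = (1/2πi) ∫_{-i∞}^{(-a+)} Γ(1+t) Γ(-t) (-z)^t / (a+t)^s dt`. The loop starts and ends at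
`-i∞` and has a circle of radius `ρ` about `t = -a`; `arg (a + t)` runs from `-π/2` to `3π/2`. -/
def branchContribution (z s a : ℂ) (ρ : ℝ) : ℂ :=
  1 / (2 * Real.pi * I) * loopIntegral (branchIntegrand z s a) (-(Real.pi / 2)) ρ

/-- `e^{-xτ} τ^{-s} (1 - e^{-τ})^n` at `τ = r e^{iθ}`, where `arg τ = θ`. -/
def pIntegrand (n : ℕ) (x s : ℂ) (r θ : ℝ) : ℂ :=
  let τ : ℂ := r * exp (θ * I)
  exp (-x * τ) * branchPow r θ (-s) * (1 - exp (-τ)) ^ n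

/-- `p_n(x,s) = ∫_{∞}^{(0+)} e^{-xτ} τ^{-s} (1 - e^{-τ})^n dτ`. The loop starts and ends at `+∞` and
has a circle of radius `δ` about `τ = 0`; `arg τ` runs from `0` to `2π`. -/
def p (n : ℕ) (x s : ℂ) (δ : ℝ) : ℂ :=
  loopIntegral (pIntegrand n x s) 0 δ

end Lerch

end

/-! The substitution `τ = 2πi(a + t)` turns the branch-point loop into a Hankel loop from `+∞` round
`0`. By the reflection formula the integrand becomes a constant times `e^{-xτ} τ^{-s} / (q e^{-τ} -
1)` with `q = e^{2πia}` (`branchIntegrand_eq`). With `v = 1 - e^{-τ}` the last factor is `1 / ((q -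
1) - q v)`, a geometric series in `q v / (q - 1)`, whose terms integrate to the `p_n`. On a small
circle `v` is small. On the ray `0 < v < 1`, so `|q| ≤ |q - 1|` makes the ratio smaller than `1` in
modulus; for integer `s` the two rays cancel and no condition is needed. The ratio may approach
modulus `1` at infinity, but the partial sums stay below twice a bound for the limit, so dominated
convergence applies (`geom_partialSum_bound_tendsto`, `tendsto_loopIntegral_laplaceKernel`).

Expanding `(1 - e^{-τ})^n` by the binomial theorem reduces `p_n` to Hankel's integral for `1/Γ(s)`
(`hankel`). The resulting sum is, up to sign, an `n`-th difference of `x^{s-1}`, which behaves like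
the `n`-th derivative (`sum_choose_mul_cpow_isLittleO`); the reflection formula at `s - n` then
gives the constant. -/

namespace Lerch

noncomputable section

open MeasureTheory Set

/-! ### Loop integrals as ray plus circle, and integrability on the ray. -/

/-- The integrand `e^{-xτ} τ^{-s} g(τ)` at `τ = r e^{iθ}`, where `arg τ = θ`. -/
def laplaceKernel (g : ℂ → ℂ) (x s : ℂ) (r θ : ℝ) : ℂ :=
  exp (-x * (r * exp (θ * I))) * branchPow r θ (-s) * g (r * exp (θ * I))

/-- The integrand `e^{-xr} r^{-s} g(r)` on the positive real axis. -/
def rayIntegrand (g : ℂ → ℂ) (x s : ℂ) (r : ℝ) : ℂ :=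
  exp (-x * r) * (r : ℂ) ^ (-s) * g r

/-- The contribution of the circle of radius `δ` to a loop integral. -/
def circlePart (g : ℂ → ℂ) (x s : ℂ) (δ : ℝ) : ℂ :=
  ∫ θ in (0 : ℝ)..(2 * Real.pi), laplaceKernel g x s δ θ * (I * (δ * exp (θ * I)))

theorem pIntegrand_eq_laplaceKernel (n : ℕ) (x s : ℂ) :
    pIntegrand n x s = laplaceKernel (fun τ => (1 - exp (-τ)) ^ n) x s := rfl

theorem branchPow_zero_arg {r : ℝ} (hr : 0 < r) (w : ℂ) : branchPow r 0 w = (r : ℂ) ^ w := by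
  rw [branchPow, cpow_def_of_ne_zero (ofReal_ne_zero.2 hr.ne'), ofReal_log hr.le]
  simp [mul_comm]

theorem branchPow_two_pi {r : ℝ} (hr : 0 < r) (w : ℂ) :
    branchPow r (2 * Real.pi) w = exp (2 * Real.pi * I * w) * (r : ℂ) ^ w := by
  rw [branchPow, cpow_def_of_ne_zero (ofReal_ne_zero.2 hr.ne'), ofReal_log hr.le, ← exp_add]
  congr 1
  push_cast
  ring

theorem laplaceKernel_zero_arg (g : ℂ → ℂ) (x s : ℂ) {r : ℝ} (hr : 0 < r) :
    laplaceKernel g x s r 0 = rayIntegrand g x s r := by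
  simp [laplaceKernel, rayIntegrand, branchPow_zero_arg hr]

theorem laplaceKernel_two_pi (g : ℂ → ℂ) (x s : ℂ) {r : ℝ} (hr : 0 < r) :
    laplaceKernel g x s r (2 * Real.pi) = exp (-2 * Real.pi * I * s) * rayIntegrand g x s r := by
  rw [laplaceKernel, rayIntegrand, branchPow_two_pi hr]
  have h : exp (((2 * Real.pi : ℝ) : ℂ) * I) = 1 := by
    push_cast
    exact exp_two_pi_mul_I
  rw [h, mul_one, show 2 * (Real.pi : ℂ) * I * -s = -2 * Real.pi * I * s by ring]
  ring

/-- Only `τ^{-s}` changes between the two sides of the cut, by the factor `e^{-2πis}`. For integer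
`s` the rays therefore cancel. -/
theorem loopIntegral_laplaceKernel (g : ℂ → ℂ) (x s : ℂ) {δ : ℝ} (hδ : 0 < δ) :
    loopIntegral (laplaceKernel g x s) 0 δ =
      (exp (-2 * Real.pi * I * s) - 1) * (∫ r in Ioi δ, rayIntegrand g x s r) +
        circlePart g x s δ := by
  have h : exp (((2 * Real.pi : ℝ) : ℂ) * I) = 1 := by
    push_cast
    exact exp_two_pi_mul_I
  have h1 : ∫ r in Ioi δ, laplaceKernel g x s r 0 * exp (((0 : ℝ) : ℂ) * I) =
      ∫ r in Ioi δ, rayIntegrand g x s r := by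
    refine setIntegral_congr_fun measurableSet_Ioi fun r hr => ?_
    simp only [laplaceKernel_zero_arg g x s (hδ.trans hr), ofReal_zero, zero_mul, exp_zero, mul_one]
  have h2 : ∫ r in Ioi δ, laplaceKernel g x s r (2 * Real.pi) *
      exp (((2 * Real.pi : ℝ) : ℂ) * I) =
      exp (-2 * Real.pi * I * s) * ∫ r in Ioi δ, rayIntegrand g x s r := by
    rw [← integral_const_mul]
    refine setIntegral_congr_fun measurableSet_Ioi fun r hr => ?_
    simp only [laplaceKernel_two_pi g x s (hδ.trans hr), h, mul_one]
  rw [loopIntegral, circlePart, zero_add, h1, h2]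
  ring

theorem loopIntegrable_laplaceKernel {g : ℂ → ℂ} {x s : ℂ} {δ : ℝ} (hδ : 0 < δ)
    (h : IntegrableOn (rayIntegrand g x s) (Ioi δ)) :
    LoopIntegrable (laplaceKernel g x s) 0 δ := by
  refine ⟨h.congr_fun (fun r hr => (laplaceKernel_zero_arg g x s (hδ.trans hr)).symm)
    measurableSet_Ioi, ?_⟩
  rw [zero_add]
  exact IntegrableOn.congr_fun (h.const_mul (exp (-2 * Real.pi * I * s)))
    (fun r hr => (laplaceKernel_two_pi g x s (hδ.trans hr)).symm) measurableSet_Ioi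

theorem norm_rayIntegrand (g : ℂ → ℂ) (x s : ℂ) {r : ℝ} (hr : 0 < r) :
    ‖rayIntegrand g x s r‖ = Real.exp (-x.re * r) * r ^ (-s.re) * ‖g r‖ := by
  rw [rayIntegrand, norm_mul, norm_mul, norm_exp, norm_cpow_eq_rpow_re_of_pos hr]
  simp

theorem continuousOn_rayIntegrand {g : ℂ → ℂ} (x s : ℂ) {S : Set ℝ} (hS : ∀ r ∈ S, 0 < r)
    (hg : ∀ r ∈ S, ContinuousAt g r) : ContinuousOn (rayIntegrand g x s) S := by
  intro r hr
  refine ContinuousAt.continuousWithinAt ?_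
  have h1 : ContinuousAt (fun r : ℝ => (r : ℂ) ^ (-s)) r :=
    (continuousAt_ofReal_cpow_const _ _ (Or.inr (hS r hr).ne'))
  have h2 : ContinuousAt (fun r : ℝ => g r) r :=
    ContinuousAt.comp (f := fun r : ℝ => (r : ℂ)) (hg r hr) continuous_ofReal.continuousAt
  have h3 : ContinuousAt (fun r : ℝ => exp (-x * r)) r := by fun_prop
  exact (h3.mul h1).mul h2

/-- On `(δ, ∞)`, `e^{-cr} r^b` is integrable. -/
theorem integrableOn_exp_mul_rpow {c : ℝ} (hc : 0 < c) (b : ℝ) {δ : ℝ} (hδ : 0 < δ) :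
    IntegrableOn (fun r : ℝ => Real.exp (-c * r) * r ^ b) (Ioi δ) := by
  -- Half of the exponential decay is spent on absorbing the power `r ^ b`.
  refine integrable_of_isBigO_exp_neg (b := c / 2) (by positivity) ?_ ?_
  · intro r hr
    have : r ≠ 0 := (hδ.trans_le hr).ne'
    exact ContinuousAt.continuousWithinAt (ContinuousAt.mul (by fun_prop)
      (Real.continuousAt_rpow_const _ _ (Or.inl this)))
  · have h := (isLittleO_rpow_exp_pos_mul_atTop b (half_pos hc)).isBigO
    have h' := (isBigO_refl (fun r : ℝ => Real.exp (-c * r)) atTop).mul h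
    refine h'.congr_right fun r => ?_
    rw [← Real.exp_add]
    congr 1
    ring

theorem integrableOn_rayIntegrand {g : ℂ → ℂ} {x s : ℂ} {δ M : ℝ} (hδ : 0 < δ) (hx : 0 < x.re)
    (hg : ∀ r : ℝ, δ < r → ContinuousAt g r) (hM : ∀ r : ℝ, δ < r → ‖g r‖ ≤ M) :
    IntegrableOn (rayIntegrand g x s) (Ioi δ) := by
  refine Integrable.mono' ((integrableOn_exp_mul_rpow hx (-s.re) hδ).mul_const M)
    ((continuousOn_rayIntegrand x s (fun r hr => hδ.trans hr) hg).aestronglyMeasurable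
      measurableSet_Ioi) ?_
  filter_upwards [ae_restrict_mem measurableSet_Ioi] with r hr
  rw [norm_rayIntegrand g x s (hδ.trans hr)]
  have := hδ.trans hr
  exact mul_le_mul_of_nonneg_left (hM r hr) (by positivity)

/-! ### Cauchy's theorem and independence of the radius. -/

theorem laplaceKernel_mul_eq (g : ℂ → ℂ) (x s : ℂ) {r : ℝ} (hr : 0 < r) (θ : ℝ) :
    laplaceKernel g x s r θ * (r * exp (θ * I)) =
      (fun ζ => exp (-x * exp ζ) * exp (-s * ζ) * g (exp ζ) * exp ζ)
        ((Real.log r : ℝ) + θ * I) := by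
  have h : exp ((Real.log r : ℝ) + θ * I) = r * exp (θ * I) := by
    rw [exp_add, ← ofReal_exp, Real.exp_log hr]
  simp only [laplaceKernel, branchPow, h]

/-- Cauchy's theorem on the annulus `δ ≤ |τ| ≤ R`, cut along the positive real axis. -/
theorem ray_add_circlePart_eq {g : ℂ → ℂ} (x s : ℂ) {δ R : ℝ} (hδ : 0 < δ) (hR : δ ≤ R)
    (hg : ∀ τ : ℂ, δ ≤ ‖τ‖ → ‖τ‖ ≤ R → DifferentiableAt ℂ g τ) :
    (exp (-2 * Real.pi * I * s) - 1) * (∫ r in δ..R, rayIntegrand g x s r) +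
        circlePart g x s δ = circlePart g x s R := by
  -- In the coordinate `ζ = log τ`, with `dτ = τ dζ`, the cut annulus is a rectangle of height `2π`
  -- on which the integrand is single-valued. The vertical sides are the circles; the top side is
  -- `e^{-2πis}` times the bottom one.
  set H : ℂ → ℂ := fun ζ => exp (-x * exp ζ) * exp (-s * ζ) * g (exp ζ) * exp ζ with hH
  have hR0 : 0 < R := hδ.trans_le hR
  have hlog : Real.log δ ≤ Real.log R := Real.log_le_log hδ hR
  have hnorm : ∀ ζ : ℂ, ζ.re ∈ Icc (Real.log δ) (Real.log R) →
      δ ≤ ‖exp ζ‖ ∧ ‖exp ζ‖ ≤ R := by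
    intro ζ hζ
    rw [norm_exp]
    exact ⟨(Real.log_le_iff_le_exp hδ).1 hζ.1, (Real.le_log_iff_exp_le hR0).1 hζ.2⟩
  have hd : ∀ ζ : ℂ, ζ.re ∈ Icc (Real.log δ) (Real.log R) → DifferentiableAt ℂ H ζ := by
    intro ζ hζ
    have h1 : DifferentiableAt ℂ (fun ζ => g (exp ζ)) ζ :=
      DifferentiableAt.comp ζ (hg _ (hnorm ζ hζ).1 (hnorm ζ hζ).2) differentiable_exp.differentiableAt
    have h2 : DifferentiableAt ℂ (fun ζ => exp (-x * exp ζ) * exp (-s * ζ)) ζ := by fun_prop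
    exact (h2.mul h1).mul differentiable_exp.differentiableAt
  have hrect := integral_boundary_rect_eq_zero_of_differentiableOn H
    ((Real.log δ : ℝ) : ℂ) ((Real.log R : ℝ) + (2 * Real.pi : ℝ) * I) (by
      intro ζ hζ
      have h := hζ.1
      simp only [add_re, ofReal_re, mul_re, I_re, mul_zero, ofReal_im, I_im, mul_one, sub_self,
        add_zero, mem_preimage, uIcc_of_le hlog] at h
      exact (hd ζ h).differentiableWithinAt)
  have e1 : ∀ r : ℝ, 0 < r → I * (∫ y in (0:ℝ)..(2 * Real.pi), H ((Real.log r : ℝ) + y * I)) =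
      circlePart g x s r := by
    intro r hr
    rw [circlePart, ← intervalIntegral.integral_const_mul]
    refine intervalIntegral.integral_congr fun θ _ => ?_
    rw [show H ((Real.log r : ℝ) + θ * I) = _ from (laplaceKernel_mul_eq g x s hr θ).symm]
    ring
  have e2 : ∫ u in Real.log δ..Real.log R, H u = ∫ r in δ..R, rayIntegrand g x s r := by
    have hpos : ∀ r ∈ uIcc δ R, 0 < r := fun r hr => by
      rw [uIcc_of_le hR] at hr
      exact hδ.trans_le hr.1
    have h := intervalIntegral.integral_deriv_smul_comp' (a := δ) (b := R) (f := Real.log)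
      (f' := fun r => r⁻¹) (g := fun u : ℝ => H u)
      (fun r hr => Real.hasDerivAt_log (hpos r hr).ne')
      (fun r hr => (continuousAt_inv₀ (hpos r hr).ne').continuousWithinAt) (by
        rintro _ ⟨r, hr, rfl⟩
        rw [uIcc_of_le hR] at hr
        have : ContinuousAt H (Real.log r : ℝ) := (hd _ (by
          rw [ofReal_re]
          exact ⟨Real.log_le_log hδ hr.1, Real.log_le_log (hδ.trans_le hr.1) hr.2⟩)).continuousAt
        exact (ContinuousAt.comp (f := fun r : ℝ => (r : ℂ)) this
          continuous_ofReal.continuousAt).continuousWithinAt)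
    rw [← h]
    refine intervalIntegral.integral_congr fun r hr => ?_
    have hr0 := hpos r hr
    have h3 := laplaceKernel_mul_eq g x s hr0 0
    rw [laplaceKernel_zero_arg g x s hr0] at h3
    simp only [ofReal_zero, zero_mul, exp_zero, mul_one, add_zero] at h3
    simp only [Function.comp_apply, real_smul, ofReal_inv]
    rw [show H (Real.log r) = _ from h3.symm]
    have : (r : ℂ) ≠ 0 := ofReal_ne_zero.2 hr0.ne'
    field_simp
  have e3 : ∀ u : ℝ, H (u + ((2 * Real.pi : ℝ) : ℂ) * I) = exp (-2 * Real.pi * I * s) * H u := by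
    intro u
    have h : exp (u + ((2 * Real.pi : ℝ) : ℂ) * I) = exp u := by
      push_cast
      exact exp_periodic u
    have h' : exp (-s * (u + ((2 * Real.pi : ℝ) : ℂ) * I)) =
        exp (-2 * Real.pi * I * s) * exp (-s * u) := by
      rw [← exp_add]
      congr 1
      push_cast
      ring
    simp only [hH, h, h']
    ring
  simp only [add_re, ofReal_re, mul_re, I_re, mul_zero, ofReal_im, I_im, mul_one, sub_self,
    add_zero, add_im, mul_im, zero_add, zero_mul, e3, smul_eq_mul, e1 R hR0, e1 δ hδ,
    intervalIntegral.integral_const_mul, e2, ofReal_zero] at hrect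
  linear_combination -hrect

/-- A loop integral does not depend on the radius of the loop. -/
theorem loopIntegral_laplaceKernel_eq {g : ℂ → ℂ} {x s : ℂ} {δ R : ℝ} (hδ : 0 < δ) (hR : δ ≤ R)
    (hg : ∀ τ : ℂ, δ ≤ ‖τ‖ → ‖τ‖ ≤ R → DifferentiableAt ℂ g τ)
    (hi : IntegrableOn (rayIntegrand g x s) (Ioi δ)) :
    loopIntegral (laplaceKernel g x s) 0 δ = loopIntegral (laplaceKernel g x s) 0 R := by
  rw [loopIntegral_laplaceKernel g x s hδ, loopIntegral_laplaceKernel g x s (hδ.trans_le hR),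
    ← ray_add_circlePart_eq x s hδ hR hg, ← intervalIntegral.integral_Ioi_sub_Ioi hi hR]
  ring

/-! ### Hankel's integral. -/

theorem exp_sub_one_mul_Gamma {s : ℂ} (hs : ∀ k : ℕ, s ≠ 1 + k) :
    (exp (-2 * Real.pi * I * s) - 1) * Gamma (1 - s) =
      -2 * Real.pi * I * exp (-Real.pi * I * s) / Gamma s := by
  have hsin : exp (-2 * Real.pi * I * s) - 1 =
      -2 * I * exp (-Real.pi * I * s) * sin (Real.pi * s) := by
    have h1 : exp (-2 * Real.pi * I * s) = exp (-Real.pi * I * s) * exp (-Real.pi * I * s) := by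
      rw [← exp_add]
      congr 1
      ring
    have h2 : exp (-Real.pi * I * s) * exp (Real.pi * I * s) = 1 := by
      rw [← exp_add, ← exp_zero]
      congr 1
      ring
    rw [sin, show -(Real.pi * s) * I = -Real.pi * I * s by ring,
      show Real.pi * s * I = Real.pi * I * s by ring]
    linear_combination h1 + h2 + (exp (-Real.pi * I * s) * (exp (-Real.pi * I * s)
      - exp (Real.pi * I * s))) * (I_mul_I)
  have hR := Complex.Gamma_mul_Gamma_one_sub s
  have h1s : Gamma (1 - s) ≠ 0 := by
    rw [Ne, Gamma_eq_zero_iff]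
    rintro ⟨m, hm⟩
    exact hs m (by linear_combination -hm)
  -- `Gamma` vanishes only by its default value at the poles `0, -1, -2, …`; there `sin (πs) = 0`,
  -- and division by zero makes the right side `0` too.
  by_cases hG : Gamma s = 0
  · obtain ⟨m, hm⟩ := (Gamma_eq_zero_iff s).1 hG
    have : sin (Real.pi * s) = 0 := by
      rw [hm, mul_comm, neg_mul, sin_neg, sin_nat_mul_pi, neg_zero]
    rw [hsin, this, hG]
    simp
  · have hsn : sin (Real.pi * s) ≠ 0 := by
      intro h
      rw [h, div_zero] at hR
      exact (mul_ne_zero hG h1s) hR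
    rw [eq_div_iff hsn] at hR
    rw [hsin, eq_div_iff hG]
    linear_combination (-2 * I * exp (-Real.pi * I * s)) * hR

theorem integrableOn_cpow_mul_exp {a x : ℂ} (ha : 0 < a.re) (hx : 0 < x.re) :
    IntegrableOn (fun t : ℝ => (t : ℂ) ^ (a - 1) * exp (-(x * t))) (Ioi 0) := by
  have h := integrableOn_rpow_mul_exp_neg_mul_rpow (s := a.re - 1) (p := 1) (b := x.re)
    (by linarith) one_pos hx
  refine Integrable.mono' h ?_ ?_
  · refine ContinuousOn.aestronglyMeasurable (fun t ht => ?_) measurableSet_Ioi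
    exact ((continuousAt_ofReal_cpow_const _ _ (Or.inr (ne_of_gt ht))).mul
      (by fun_prop)).continuousWithinAt
  · filter_upwards [ae_restrict_mem measurableSet_Ioi] with t ht
    rw [norm_mul, norm_exp, norm_cpow_eq_rpow_re_of_pos ht]
    simp

theorem differentiableAt_laplace {a x : ℂ} (ha : 0 < a.re) (hx : 0 < x.re) :
    DifferentiableAt ℂ
      (fun x : ℂ => ∫ t : ℝ in Ioi 0, (t : ℂ) ^ (a - 1) * exp (-(x * t))) x := by
  -- Keeping `Re y` above `Re x / 2` gives one integrable bound for all the derivatives of the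
  -- integrand near `x`.
  have hU : {y : ℂ | x.re / 2 < y.re} ∈ 𝓝 x :=
    (isOpen_lt continuous_const continuous_re).mem_nhds (by simp only [mem_ofPred_eq]; linarith)
  have hcont : ∀ (b y : ℂ), AEStronglyMeasurable
      (fun t : ℝ => (t : ℂ) ^ b * exp (-(y * t))) (volume.restrict (Ioi 0)) := fun b y =>
    ContinuousOn.aestronglyMeasurable (fun t ht =>
      ((continuousAt_ofReal_cpow_const _ _ (Or.inr (ne_of_gt ht))).mul
        (by fun_prop)).continuousWithinAt) measurableSet_Ioi
  have ha' : -1 < a.re := by linarith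
  refine (hasDerivAt_integral_of_dominated_loc_of_deriv_le (μ := volume.restrict (Ioi (0 : ℝ)))
    (F := fun y t => (t : ℂ) ^ (a - 1) * exp (-(y * t)))
    (F' := fun y t => (t : ℂ) ^ (a - 1) * (exp (-(y * t)) * (-(t : ℂ))))
    (bound := fun t => t ^ a.re * Real.exp (-(x.re / 2) * t ^ (1 : ℝ))) hU
    (Eventually.of_forall fun y => hcont (a - 1) y) (integrableOn_cpow_mul_exp ha hx) ?_ ?_
    (integrableOn_rpow_mul_exp_neg_mul_rpow ha' one_pos (half_pos hx))
    ?_).2.differentiableAt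
  · have := (hcont (a - 1) x).mul
      (continuous_ofReal.neg.aestronglyMeasurable (μ := volume.restrict (Ioi (0 : ℝ))))
    refine this.congr (Eventually.of_forall fun t => ?_)
    simp [mul_assoc]
  · filter_upwards [ae_restrict_mem measurableSet_Ioi] with t ht y hy
    have ht : 0 < t := ht
    rw [norm_mul, norm_mul, norm_exp, norm_cpow_eq_rpow_re_of_pos ht, norm_neg, norm_real,
      Real.norm_of_nonneg ht.le, Real.rpow_one, sub_re, one_re, Real.rpow_sub_one ht.ne']
    have : Real.exp (-(y * t)).re ≤ Real.exp (-(x.re / 2) * t) := by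
      apply Real.exp_le_exp.2
      simp only [neg_re, re_mul_ofReal]
      have : x.re / 2 < y.re := hy
      nlinarith
    calc t ^ a.re / t * (Real.exp (-(y * t)).re * t)
        = t ^ a.re * Real.exp (-(y * t)).re := by field_simp
      _ ≤ _ := by gcongr
  · refine Eventually.of_forall fun t y _ => ?_
    have h : HasDerivAt (fun y : ℂ => -(y * t)) (-(1 * (t : ℂ))) y :=
      ((hasDerivAt_id y).mul_const _).neg
    rw [one_mul] at h
    exact h.cexp.const_mul _

/-- The Laplace transform of `t ^ (a - 1)` in the right half-plane. -/
theorem integral_cpow_mul_exp_neg_mul {a x : ℂ} (ha : 0 < a.re) (hx : 0 < x.re) :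
    ∫ t : ℝ in Ioi 0, (t : ℂ) ^ (a - 1) * exp (-(x * t)) = x ^ (-a) * Gamma a := by
  have hopen : IsOpen {x : ℂ | 0 < x.re} := isOpen_lt continuous_const continuous_re
  have hf : AnalyticOnNhd ℂ
      (fun x : ℂ => ∫ t : ℝ in Ioi 0, (t : ℂ) ^ (a - 1) * exp (-(x * t))) {x : ℂ | 0 < x.re} :=
    DifferentiableOn.analyticOnNhd
      (fun y hy => (differentiableAt_laplace ha hy).differentiableWithinAt) hopen
  have hg : AnalyticOnNhd ℂ (fun x : ℂ => x ^ (-a) * Gamma a) {x : ℂ | 0 < x.re} := by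
    refine DifferentiableOn.analyticOnNhd (fun y hy => ?_) hopen
    have : y ∈ slitPlane := Or.inl hy
    exact ((differentiableAt_id.cpow_const this).mul_const _).differentiableWithinAt
  refine hf.eqOn_of_preconnected_of_frequently_eq hg
    (convex_halfSpace_re_gt 0).isPreconnected (z₀ := 1) (by simp) ?_ hx
  -- The formula is known for positive real `x`; the points `1 + 1/(n+1)` accumulate at `1`, and the
  -- identity theorem does the rest.
  have hu : Tendsto (fun n : ℕ => ((1 + 1 / ((n : ℝ) + 1) : ℝ) : ℂ)) atTop (𝓝[≠] 1) := by
    refine tendsto_nhdsWithin_iff.2 ⟨?_, Eventually.of_forall fun n => ?_⟩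
    · have := (tendsto_one_div_add_atTop_nhds_zero_nat (𝕜 := ℝ)).const_add 1
      rw [add_zero] at this
      exact_mod_cast (continuous_ofReal.tendsto _).comp this
    · have : (1 + 1 / ((n : ℝ) + 1) : ℝ) ≠ 1 := by
        have : 0 < 1 / ((n : ℝ) + 1) := by positivity
        linarith
      rw [mem_compl_singleton_iff, Ne, ofReal_eq_one]
      exact this
  refine hu.frequently (Frequently.of_forall fun n => ?_)
  have hn : 0 < 1 + 1 / ((n : ℝ) + 1) := by positivity
  rw [integral_cpow_mul_exp_neg_mul_Ioi ha hn, one_div, inv_cpow, cpow_neg]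
  rw [arg_ofReal_of_nonneg hn.le]
  exact Real.pi_pos.ne

theorem norm_laplaceKernel_le (g : ℂ → ℂ) (x s : ℂ) {r θ : ℝ} (hr : 0 < r)
    (hθ : θ ∈ Icc 0 (2 * Real.pi)) :
    ‖laplaceKernel g x s r θ‖ ≤ Real.exp (‖x‖ * r) * (r ^ (-s.re) *
      Real.exp (2 * Real.pi * |s.im|)) * ‖g (r * exp (θ * I))‖ := by
  rw [laplaceKernel, norm_mul, norm_mul]
  gcongr
  · refine (norm_exp_le_exp_norm _).trans (Real.exp_le_exp.2 ?_)
    rw [norm_mul, norm_neg, norm_mul, norm_exp_ofReal_mul_I, mul_one, norm_real,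
      Real.norm_of_nonneg hr.le]
  · rw [branchPow, norm_exp, Real.rpow_def_of_pos hr, ← Real.exp_add]
    apply Real.exp_le_exp.2
    simp only [mul_re, neg_re, add_re, ofReal_re, I_re, mul_zero, ofReal_im, I_im, mul_one,
      sub_self, add_zero, neg_im, add_im, mul_im, zero_add]
    have h1 : s.im * θ ≤ |s.im| * (2 * Real.pi) :=
      mul_le_mul (le_abs_self _) hθ.2 hθ.1 (abs_nonneg _)
    linarith

/-- The circle contributes `O(ε^{1 - Re s})`. -/
theorem tendsto_circlePart_one (x : ℂ) {s : ℂ} (hs : s.re < 1) :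
    Tendsto (circlePart (fun _ => 1) x s) (𝓝[>] 0) (𝓝 0) := by
  have hlim : Tendsto (fun ε : ℝ => Real.exp (‖x‖ * ε) * (ε ^ (1 - s.re) *
      Real.exp (2 * Real.pi * |s.im|)) * |2 * Real.pi - 0|) (𝓝[>] 0) (𝓝 0) := by
    have h1 : ContinuousAt (fun ε : ℝ => ε ^ (1 - s.re)) 0 :=
      Real.continuousAt_rpow_const _ _ (Or.inr (by linarith))
    have h2 : ContinuousAt (fun ε : ℝ => Real.exp (‖x‖ * ε) * (ε ^ (1 - s.re) *
      Real.exp (2 * Real.pi * |s.im|)) * |2 * Real.pi - 0|) 0 := by fun_prop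
    have h3 := h2.tendsto
    rw [Real.zero_rpow (by linarith)] at h3
    simp only [mul_zero, zero_mul] at h3
    exact h3.mono_left nhdsWithin_le_nhds
  refine squeeze_zero_norm' ?_ hlim
  filter_upwards [self_mem_nhdsWithin] with ε hε
  have hε : 0 < ε := hε
  refine intervalIntegral.norm_integral_le_of_norm_le_const fun θ hθ => ?_
  rw [uIoc_of_le Real.two_pi_pos.le] at hθ
  have h := norm_laplaceKernel_le (fun _ => 1) x s hε ⟨hθ.1.le, hθ.2⟩
  rw [norm_mul, norm_mul, norm_I, norm_mul, norm_exp_ofReal_mul_I, norm_real,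
    Real.norm_of_nonneg hε.le, one_mul, mul_one]
  calc _ ≤ _ := mul_le_mul_of_nonneg_right h hε.le
    _ = _ := by
      rw [show 1 - s.re = -s.re + 1 by ring, Real.rpow_add_one hε.ne', norm_one]
      ring

theorem integrableOn_rayIntegrand_one {x : ℂ} (hx : 0 < x.re) (s : ℂ) {δ : ℝ} (hδ : 0 < δ) :
    IntegrableOn (rayIntegrand (fun _ => 1) x s) (Ioi δ) :=
  integrableOn_rayIntegrand (M := 1) hδ hx (fun _ _ => continuousAt_const) (fun _ _ => by simp)

/-- Shrinking the circle to `0` leaves only the rays, which form a Gamma integral. -/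
theorem hankel_of_re_lt_one {x s : ℂ} (hx : 0 < x.re) (hs : s.re < 1) {δ : ℝ} (hδ : 0 < δ) :
    loopIntegral (laplaceKernel (fun _ => 1) x s) 0 δ =
      (exp (-2 * Real.pi * I * s) - 1) * Gamma (1 - s) * x ^ (s - 1) := by
  have ha : 0 < (1 - s).re := by rw [sub_re, one_re]; linarith
  have hray : rayIntegrand (fun _ => 1) x s =
      fun t : ℝ => (t : ℂ) ^ ((1 - s) - 1) * exp (-(x * t)) := by
    funext t
    rw [rayIntegrand, mul_one, mul_comm, neg_mul]
    congr 2
    ring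
  have hint : IntegrableOn (rayIntegrand (fun _ => 1) x s) (Ioi 0) := by
    rw [hray]
    exact integrableOn_cpow_mul_exp ha hx
  have hval : ∫ t in Ioi 0, rayIntegrand (fun _ => 1) x s t = x ^ (s - 1) * Gamma (1 - s) := by
    rw [hray, integral_cpow_mul_exp_neg_mul ha hx, neg_sub]
  have h1 : Tendsto (fun ε : ℝ => ∫ t in Ioi ε, rayIntegrand (fun _ => 1) x s t) (𝓝[>] 0)
      (𝓝 (x ^ (s - 1) * Gamma (1 - s))) := by
    have hc : AECover (volume.restrict (Ioi (0 : ℝ))) (𝓝[>] 0) (fun ε : ℝ => Ioi ε) :=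
      aecover_Ioi_of_Ioi (tendsto_id.mono_left nhdsWithin_le_nhds)
    have := hc.integral_tendsto_of_countably_generated hint
    rw [hval] at this
    refine this.congr' ?_
    filter_upwards [self_mem_nhdsWithin] with ε hε
    rw [Measure.restrict_restrict measurableSet_Ioi,
      inter_eq_left.2 (Ioi_subset_Ioi (le_of_lt hε))]
  have h2 := (h1.const_mul (exp (-2 * Real.pi * I * s) - 1)).add (tendsto_circlePart_one x hs)
  have h3 : Tendsto (fun _ : ℝ => loopIntegral (laplaceKernel (fun _ => 1) x s) 0 δ) (𝓝[>] 0)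
      (𝓝 ((exp (-2 * Real.pi * I * s) - 1) * (x ^ (s - 1) * Gamma (1 - s)) + 0)) := by
    refine h2.congr' ?_
    filter_upwards [Ioc_mem_nhdsGT hδ] with ε hε
    rw [← loopIntegral_laplaceKernel _ x s hε.1]
    exact loopIntegral_laplaceKernel_eq hε.1 hε.2
      (fun _ _ _ => differentiableAt_const _) (integrableOn_rayIntegrand_one hx s hε.1)
  rw [tendsto_nhds_unique tendsto_const_nhds h3]
  ring

/-- This is integration of the derivative of `e^{-xτ} τ^{-s}` along the loop. The boundary terms at
infinity vanish, and those where the rays meet the circle cancel. -/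
theorem hankel_recurrence {x : ℂ} (hx : 0 < x.re) (s : ℂ) {δ : ℝ} (hδ : 0 < δ) :
    x * loopIntegral (laplaceKernel (fun _ => 1) x s) 0 δ +
      s * loopIntegral (laplaceKernel (fun _ => 1) x (s + 1)) 0 δ = 0 := by
  have hper : exp (-2 * Real.pi * I * (s + 1)) = exp (-2 * Real.pi * I * s) := by
    rw [show -2 * (Real.pi : ℂ) * I * (s + 1) = -2 * Real.pi * I * s - 2 * Real.pi * I by ring]
    exact exp_periodic.sub_eq _
  have i1 := integrableOn_rayIntegrand_one hx s hδ
  have i2 := integrableOn_rayIntegrand_one hx (s + 1) hδ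
  have hray : x * (∫ r in Ioi δ, rayIntegrand (fun _ => 1) x s r) +
      s * (∫ r in Ioi δ, rayIntegrand (fun _ => 1) x (s + 1) r) =
      rayIntegrand (fun _ => 1) x s δ := by
    have h := integral_Ioi_of_hasDerivAt_of_tendsto' (a := δ) (m := 0)
      (f := rayIntegrand (fun _ => 1) x s)
      (f' := fun r => (-x) * rayIntegrand (fun _ => 1) x s r +
        (-s) * rayIntegrand (fun _ => 1) x (s + 1) r) (by
        intro r hr
        have hr : 0 < r := hδ.trans_le hr
        have d1 : HasDerivAt (fun y : ℂ => exp (-x * y) * y ^ (-s))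
            (exp (-x * r) * (-x * 1) * (r : ℂ) ^ (-s) +
              exp (-x * r) * (-s * (r : ℂ) ^ (-s - 1) * 1)) (r : ℂ) :=
          (((hasDerivAt_id _).const_mul (-x)).cexp).mul
            ((hasDerivAt_id _).cpow_const (Or.inl (by simpa using hr)))
        have d2 := d1.comp_ofReal
        refine (d2.congr_of_eventuallyEq ?_).congr_deriv ?_
        · exact Eventually.of_forall fun y => by simp [rayIntegrand]
        · simp only [rayIntegrand, neg_add', mul_one]
          ring)
      ((i1.const_mul _).add (i2.const_mul _)) (by
        rw [tendsto_zero_iff_norm_tendsto_zero]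
        refine (tendsto_rpow_mul_exp_neg_mul_atTop_nhds_zero (-s.re) x.re hx).congr' ?_
        filter_upwards [eventually_gt_atTop 0] with r hr
        rw [norm_rayIntegrand _ x s hr, norm_one, mul_one, mul_comm])
    rw [integral_add (i1.const_mul _) (i2.const_mul _), integral_const_mul, integral_const_mul] at h
    linear_combination -h
  have hcirc : x * circlePart (fun _ => 1) x s δ + s * circlePart (fun _ => 1) x (s + 1) δ =
      -(exp (-2 * Real.pi * I * s) - 1) * rayIntegrand (fun _ => 1) x s δ := by
    have hbr : ∀ θ : ℝ, branchPow δ θ (-(s + 1)) * (δ * exp (θ * I)) = branchPow δ θ (-s) := by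
      intro θ
      have : (δ : ℂ) * exp (θ * I) = exp (Real.log δ + θ * I) := by
        rw [exp_add, ← ofReal_exp, Real.exp_log hδ]
      rw [this, branchPow, branchPow, ← exp_add]
      congr 1
      ring
    have hc : ∀ s : ℂ, Continuous fun θ : ℝ =>
        laplaceKernel (fun _ => 1) x s δ θ * (I * (δ * exp (θ * I))) := fun s => by
      unfold laplaceKernel branchPow
      fun_prop
    have h := intervalIntegral.integral_eq_sub_of_hasDerivAt (a := 0) (b := 2 * Real.pi)
      (f := laplaceKernel (fun _ => 1) x s δ)
      (f' := fun θ => (-x) * (laplaceKernel (fun _ => 1) x s δ θ * (I * (δ * exp (θ * I)))) +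
        (-s) * (laplaceKernel (fun _ => 1) x (s + 1) δ θ * (I * (δ * exp (θ * I))))) (by
        intro θ _
        have d0 : HasDerivAt (fun θ : ℝ => (θ : ℂ) * I) I θ := by
          simpa using (hasDerivAt_id θ).ofReal_comp.mul_const I
        have d1 : HasDerivAt (fun θ : ℝ => exp (-x * (δ * exp (θ * I))))
            (exp (-x * (δ * exp (θ * I))) * (-x * (δ * (exp (θ * I) * I)))) θ :=
          ((d0.cexp.const_mul (δ : ℂ)).const_mul (-x)).cexp
        have d2 : HasDerivAt (fun θ : ℝ => branchPow δ θ (-s))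
            (branchPow δ θ (-s) * (-s * I)) θ :=
          ((d0.const_add (Real.log δ : ℂ)).const_mul (-s)).cexp
        refine ((d1.mul d2).congr_of_eventuallyEq ?_).congr_deriv ?_
        · exact Eventually.of_forall fun y => by simp [laplaceKernel]
        · simp only [laplaceKernel, mul_one]
          linear_combination (exp (-x * (δ * exp (θ * I))) * s * I) * hbr θ)
      ((((hc s).const_mul _).add ((hc (s + 1)).const_mul _)).intervalIntegrable _ _)
    rw [intervalIntegral.integral_add (((hc s).const_mul _).intervalIntegrable _ _)
      (((hc (s + 1)).const_mul _).intervalIntegrable _ _), intervalIntegral.integral_const_mul,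
      intervalIntegral.integral_const_mul, laplaceKernel_two_pi _ _ _ hδ,
      laplaceKernel_zero_arg _ _ _ hδ] at h
    simp only [circlePart]
    linear_combination -h
  rw [loopIntegral_laplaceKernel _ x s hδ, loopIntegral_laplaceKernel _ x _ hδ, hper]
  linear_combination (exp (-2 * Real.pi * I * s) - 1) * hray + hcirc

/-- The recurrence from `s = 0` to `s = 1` has coefficient `0` and says nothing about `s = 1`. There
the rays cancel and the circle gives the residue at a simple pole. -/
theorem hankel_one (x : ℂ) {δ : ℝ} (hδ : 0 < δ) :
    loopIntegral (laplaceKernel (fun _ => 1) x 1) 0 δ = 2 * Real.pi * I := by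
  have hper : exp (-2 * Real.pi * I * 1) = 1 := by
    rw [show -2 * (Real.pi : ℂ) * I * 1 = -(2 * Real.pi * I) by ring, exp_neg, exp_two_pi_mul_I,
      inv_one]
  rw [loopIntegral_laplaceKernel _ x 1 hδ, hper, sub_self, zero_mul, zero_add]
  have h := circleIntegral_sub_center_inv_smul_of_differentiable_on_off_countable hδ
    (f := fun τ => exp (-x * τ)) (c := 0) countable_empty
    (Continuous.continuousOn (by fun_prop)) (fun z _ => by fun_prop)
  simp only [mul_zero, exp_zero, smul_eq_mul, mul_one, sub_zero] at h
  rw [← h, circlePart, circleIntegral]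
  refine intervalIntegral.integral_congr fun θ _ => ?_
  have : (δ : ℂ) * exp (θ * I) = exp (Real.log δ + θ * I) := by
    rw [exp_add, ← ofReal_exp, Real.exp_log hδ]
  simp only [laplaceKernel, branchPow, deriv_circleMap, circleMap, zero_add, smul_eq_mul, mul_one,
    this, neg_mul, one_mul, exp_neg]
  ring

/-- Hankel's integral. -/
theorem hankel {x : ℂ} (hx : 0 < x.re) (s : ℂ) {δ : ℝ} (hδ : 0 < δ) :
    loopIntegral (laplaceKernel (fun _ => 1) x s) 0 δ =
      -2 * Real.pi * I * exp (-Real.pi * I * s) / Gamma s * x ^ (s - 1) := by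
  have hx0 : x ≠ 0 := by
    rintro rfl
    simp at hx
  -- The half-plane `Re s < 1` is widened by one unit at a time through the recurrence.
  have key : ∀ (k : ℕ) (s : ℂ), s.re < 1 + k →
      loopIntegral (laplaceKernel (fun _ => 1) x s) 0 δ =
        -2 * Real.pi * I * exp (-Real.pi * I * s) / Gamma s * x ^ (s - 1) := by
    intro k
    induction k with
    | zero =>
      intro s hs
      simp only [Nat.cast_zero, add_zero] at hs
      rw [hankel_of_re_lt_one hx hs hδ, exp_sub_one_mul_Gamma]
      rintro k rfl
      simp only [add_re, one_re, natCast_re] at hs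
      have : (0 : ℝ) ≤ k := k.cast_nonneg
      linarith
    | succ k ih =>
      intro s hs
      by_cases h1 : s = 1
      · have he : exp (-Real.pi * I * 1) = -1 := by
          rw [show -(Real.pi : ℂ) * I * 1 = -(Real.pi * I) by ring, exp_neg, exp_pi_mul_I]
          norm_num
        rw [h1, hankel_one x hδ, he, Gamma_one, sub_self, cpow_zero]
        ring
      · have h0 : s - 1 ≠ 0 := sub_ne_zero.2 h1
        have hre : (s - 1).re < 1 + k := by
          push_cast at hs
          rw [sub_re, one_re]
          linarith
        have hrec := hankel_recurrence hx (s - 1) hδ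
        rw [ih (s - 1) hre, sub_add_cancel] at hrec
        have hG := Gamma_add_one (s - 1) h0
        rw [sub_add_cancel] at hG
        have he : exp (-Real.pi * I * (s - 1)) = -exp (-Real.pi * I * s) := by
          rw [show -(Real.pi : ℂ) * I * (s - 1) = -Real.pi * I * s + Real.pi * I by ring,
            exp_add, exp_pi_mul_I, mul_neg_one]
        have hp : x ^ (s - 1) = x * x ^ (s - 1 - 1) := by
          rw [cpow_sub (s - 1) 1 hx0, cpow_one, mul_comm, div_mul_cancel₀ _ hx0]
        refine mul_left_cancel₀ h0 ?_
        rw [he] at hrec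
        rw [hG, hp]
        -- At a pole of `Γ` the default value `0` and division by zero encode `1/Γ = 0`.
        by_cases hGz : Gamma (s - 1) = 0
        · rw [hGz] at hrec ⊢
          simpa using hrec
        · field_simp at hrec ⊢
          linear_combination hrec
  obtain ⟨k, hk⟩ := exists_nat_gt s.re
  exact key k s (by linarith)

/-! ### The loop integrals `p_n` as binomial sums. -/

theorem loopIntegral_sum {ι : Type*} (t : Finset ι) (c : ι → ℂ) {F : ι → ℝ → ℝ → ℂ} {θ₀ ρ : ℝ}
    (hF : ∀ i ∈ t, LoopIntegrable (F i) θ₀ ρ)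
    (hF' : ∀ i ∈ t, IntervalIntegrable (fun θ : ℝ => F i ρ θ * (I * (ρ * exp (θ * I)))) volume θ₀
      (θ₀ + 2 * Real.pi)) :
    loopIntegral (fun r θ => ∑ i ∈ t, c i * F i r θ) θ₀ ρ =
      ∑ i ∈ t, c i * loopIntegral (F i) θ₀ ρ := by
  simp only [loopIntegral, Finset.sum_mul, mul_assoc]
  rw [integral_finsetSum _ fun i hi => (((hF i hi).1.mul_const _).const_mul _),
    integral_finsetSum _ fun i hi => (((hF i hi).2.mul_const _).const_mul _),
    intervalIntegral.integral_finsetSum fun i hi => ((hF' i hi).const_mul _)]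
  simp only [integral_const_mul, intervalIntegral.integral_const_mul]
  rw [← Finset.sum_neg_distrib, ← Finset.sum_add_distrib, ← Finset.sum_add_distrib]
  exact Finset.sum_congr rfl fun i _ => by ring

theorem continuous_laplaceKernel_circle {g : ℂ → ℂ} (x s : ℂ) {δ : ℝ} (hδ : 0 < δ)
    (hg : ∀ τ : ℂ, ‖τ‖ = δ → ContinuousAt g τ) :
    Continuous fun θ : ℝ => laplaceKernel g x s δ θ * (I * (δ * exp (θ * I))) := by
  have h : Continuous fun θ : ℝ => g (δ * exp (θ * I)) := by
    refine continuous_iff_continuousAt.2 fun θ => ?_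
    refine ContinuousAt.comp (f := fun θ : ℝ => (δ : ℂ) * exp (θ * I)) (hg _ ?_) (by fun_prop)
    rw [norm_mul, norm_exp_ofReal_mul_I, mul_one, norm_real, Real.norm_of_nonneg hδ.le]
  have h0 : Continuous fun θ : ℝ => exp (-x * (δ * exp (θ * I))) * branchPow δ θ (-s) := by
    unfold branchPow
    fun_prop
  exact (h0.mul h).mul (by fun_prop)

theorem integrableOn_rayIntegrand_pow (n : ℕ) {x : ℂ} (hx : 0 < x.re) (s : ℂ) {δ : ℝ} (hδ : 0 < δ) :
    IntegrableOn (rayIntegrand (fun τ => (1 - exp (-τ)) ^ n) x s) (Ioi δ) := by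
  refine integrableOn_rayIntegrand (M := 1) hδ hx (fun r _ => by fun_prop) fun r hr => ?_
  rw [norm_pow]
  refine pow_le_one₀ (norm_nonneg _) ?_
  have h : (1 : ℂ) - exp (-r) = ((1 - Real.exp (-r) : ℝ) : ℂ) := by push_cast; rfl
  have h1 : Real.exp (-r) ≤ 1 := Real.exp_le_one_iff.2 (by linarith)
  rw [h, norm_real, Real.norm_of_nonneg (by linarith)]
  linarith [Real.exp_pos (-r)]

theorem p_eq_sum (n : ℕ) {x : ℂ} (hx : 0 < x.re) (s : ℂ) {δ : ℝ} (hδ : 0 < δ) :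
    p n x s δ = -2 * Real.pi * I * exp (-Real.pi * I * s) / Gamma s *
      ∑ m ∈ Finset.range (n + 1), (n.choose m : ℂ) * (-1) ^ m * (x + m) ^ (s - 1) := by
  have hxm : ∀ m : ℕ, 0 < (x + m).re := fun m => by
    rw [add_re, natCast_re]
    positivity
  have hF : pIntegrand n x s = fun r θ => ∑ m ∈ Finset.range (n + 1),
      ((n.choose m : ℂ) * (-1) ^ m) * laplaceKernel (fun _ => 1) (x + m) s r θ := by
    funext r θ
    simp only [pIntegrand, laplaceKernel]
    generalize (r : ℂ) * exp (θ * I) = τ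
    rw [sub_eq_neg_add, add_pow, Finset.mul_sum]
    refine Finset.sum_congr rfl fun m _ => ?_
    have h : exp (-(x + m) * τ) = exp (-x * τ) * exp (-τ) ^ m := by
      rw [← exp_nat_mul, ← exp_add]
      congr 1
      ring
    rw [h, neg_pow]
    ring
  rw [p, hF, loopIntegral_sum _ (fun m : ℕ => (n.choose m : ℂ) * (-1) ^ m)
    (F := fun m : ℕ => laplaceKernel (fun _ => 1) (x + m) s)
    (fun m _ => loopIntegrable_laplaceKernel hδ (integrableOn_rayIntegrand_one (hxm m) s hδ))
    (fun m _ => (continuous_laplaceKernel_circle _ s hδ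
      fun _ _ => continuousAt_const).intervalIntegrable _ _), Finset.mul_sum]
  refine Finset.sum_congr rfl fun m _ => ?_
  rw [hankel (hxm m) s hδ]
  ring

/-! ### Finite differences and the asymptotics of `p_n`. -/

theorem sum_choose_mul_eq_fwdDiff (n : ℕ) (f : ℂ → ℂ) (y : ℂ) :
    ∑ m ∈ Finset.range (n + 1), (n.choose m : ℂ) * (-1) ^ m * f (y + m) =
      (-1) ^ n * (fwdDiff 1)^[n] f y := by
  rw [fwdDiff_iter_eq_sum_shift, Finset.mul_sum]
  refine Finset.sum_congr rfl fun m hm => ?_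
  obtain ⟨k, rfl⟩ := Nat.exists_eq_add_of_le (Finset.mem_range_succ_iff.1 hm)
  rw [Nat.add_sub_cancel_left]
  have h : (-1 : ℂ) ^ k * (-1) ^ k = 1 := by rw [← mul_pow]; norm_num
  simp only [zsmul_eq_mul, nsmul_eq_mul, mul_one]
  push_cast
  rw [pow_add]
  linear_combination (-((m + k).choose m : ℂ) * (-1) ^ m * f (y + m)) * h

theorem sum_choose_mul_pow {n k : ℕ} (hk : k ≤ n) :
    ∑ m ∈ Finset.range (n + 1), (n.choose m : ℂ) * (-1) ^ m * (m : ℂ) ^ k =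
      if k = n then (-1) ^ n * (n.factorial : ℂ) else 0 := by
  have h := sum_choose_mul_eq_fwdDiff n (fun r => r ^ k) 0
  simp only [zero_add] at h
  rw [h]
  split_ifs with hkn
  · rw [hkn, fwdDiff_iter_eq_factorial]
    rfl
  · rw [fwdDiff_iter_pow_eq_zero_of_lt (lt_of_le_of_ne hk hkn), Pi.zero_apply, mul_zero]

/-- Both `x` and `1 + m/x` lie in the right half-plane, so their arguments add without leaving `(-π,
π)`. -/
theorem add_natCast_cpow {x : ℂ} (hx : 0 < x.re) (m : ℕ) (b : ℂ) :
    (x + m) ^ b = x ^ b * (1 + m * x⁻¹) ^ b := by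
  have hx0 : x ≠ 0 := by
    rintro rfl
    simp at hx
  have hy : 0 < (1 + m * x⁻¹).re := by
    have : 0 ≤ (m * x⁻¹).re := by
      rw [← ofReal_natCast, re_ofReal_mul, inv_re]
      have := normSq_nonneg x
      positivity
    rw [add_re, one_re]
    linarith
  have hy0 : 1 + m * x⁻¹ ≠ 0 := by
    intro h
    rw [h] at hy
    simp at hy
  have hxy : x + m = x * (1 + m * x⁻¹) := by field_simp
  have h1 := abs_lt.1 (abs_arg_lt_pi_div_two_iff.2 (Or.inl hx))
  have h2 := abs_lt.1 (abs_arg_lt_pi_div_two_iff.2 (Or.inl hy))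
  rw [hxy, cpow_def_of_ne_zero (mul_ne_zero hx0 hy0), cpow_def_of_ne_zero hx0,
    cpow_def_of_ne_zero hy0, log_mul hx0 hy0 ⟨by linarith, by linarith⟩, ← exp_add]
  congr 1
  ring

theorem binomial_remainder_isBigO (b : ℂ) (n : ℕ) :
    (fun u : ℂ => (1 + u) ^ b - ∑ k ∈ Finset.range n, Ring.choose b k * u ^ k)
      =O[𝓝 0] fun u => u ^ n := by
  have h := (one_add_cpow_hasFPowerSeriesAt_zero (a := b)).isBigO_sub_partialSum_pow n
  refine (h.congr_left fun u => ?_).trans (isBigO_of_le _ fun u => by simp)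
  simp [FormalMultilinearSeries.partialSum, binomialSeries, mul_comm]

/-- The `n`-th difference of `x ^ b` is asymptotic to its `n`-th derivative. -/
theorem sum_choose_mul_cpow_isLittleO (n : ℕ) (b : ℂ) :
    (fun x : ℂ => ∑ m ∈ Finset.range (n + 1), (n.choose m : ℂ) * (-1) ^ m * (x + m) ^ b -
      (-1) ^ n * n.factorial * Ring.choose b n * (x ^ b * x⁻¹ ^ n))
      =o[Bornology.cobounded ℂ ⊓ 𝓟 {x : ℂ | 0 < x.re}] fun x => x ^ b * x⁻¹ ^ n := by
  set R : ℂ → ℂ := fun u => (1 + u) ^ b - ∑ k ∈ Finset.range (n + 1), Ring.choose b k * u ^ k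
    with hR
  have hinv : Tendsto (fun x : ℂ => x⁻¹) (Bornology.cobounded ℂ ⊓ 𝓟 {x : ℂ | 0 < x.re}) (𝓝 0) :=
    tendsto_inv₀_cobounded.mono_left inf_le_left
  -- The remainder is `O(u^{n+1})` at `u = m/x`, one order better than required.
  have hRm : ∀ m : ℕ, (fun x : ℂ => R (m * x⁻¹))
      =o[Bornology.cobounded ℂ ⊓ 𝓟 {x : ℂ | 0 < x.re}] fun x => x⁻¹ ^ n := by
    intro m
    have h0 : Tendsto (fun x : ℂ => (m : ℂ) * x⁻¹)
        (Bornology.cobounded ℂ ⊓ 𝓟 {x : ℂ | 0 < x.re}) (𝓝 0) := by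
      simpa using hinv.const_mul (m : ℂ)
    have h1 := (binomial_remainder_isBigO b (n + 1)).comp_tendsto h0
    have h2 : (fun x : ℂ => ((m : ℂ) * x⁻¹) ^ (n + 1)) =O[Bornology.cobounded ℂ ⊓
        𝓟 {x : ℂ | 0 < x.re}] fun x : ℂ => x⁻¹ ^ (n + 1) := by
      simp only [mul_pow]
      exact isBigO_const_mul_self _ _ _
    have h3 : (fun x : ℂ => x⁻¹ ^ (n + 1)) =o[Bornology.cobounded ℂ ⊓
        𝓟 {x : ℂ | 0 < x.re}] fun x : ℂ => x⁻¹ ^ n :=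
      (isLittleO_pow_pow (Nat.lt_succ_self n)).comp_tendsto hinv
    exact (h1.trans h2).trans_isLittleO h3
  have hsum : (fun x : ℂ => ∑ m ∈ Finset.range (n + 1), ((n.choose m : ℂ) * (-1) ^ m) *
      R (m * x⁻¹)) =o[Bornology.cobounded ℂ ⊓ 𝓟 {x : ℂ | 0 < x.re}] fun x => x⁻¹ ^ n :=
    (IsLittleO.sum (s := Finset.range (n + 1))
      fun m _ => (hRm m).const_mul_left ((n.choose m : ℂ) * (-1) ^ m)).congr_left
      fun x => by simp only [Finset.sum_apply]
  refine ((isBigO_refl (fun x : ℂ => x ^ b) _).mul_isLittleO hsum).congr' ?_ EventuallyEq.rfl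
  filter_upwards [mem_inf_of_right (mem_principal_self {x : ℂ | 0 < x.re})] with x hx
  have hx : 0 < x.re := hx
  -- The alternating binomial sum kills `m^k` for `k < n`, so only the term of order `n` of the
  -- expansion survives.
  have e1 : ∑ m ∈ Finset.range (n + 1), (n.choose m : ℂ) * (-1) ^ m *
      (∑ k ∈ Finset.range (n + 1), Ring.choose b k * (m * x⁻¹) ^ k) =
      (-1) ^ n * n.factorial * Ring.choose b n * x⁻¹ ^ n := by
    simp only [Finset.mul_sum]
    rw [Finset.sum_comm]
    have : ∀ k ∈ Finset.range (n + 1), ∑ m ∈ Finset.range (n + 1),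
        (n.choose m : ℂ) * (-1) ^ m * (Ring.choose b k * (m * x⁻¹) ^ k) =
        if k = n then (-1) ^ n * n.factorial * Ring.choose b n * x⁻¹ ^ n else 0 := by
      intro k hk
      have h := sum_choose_mul_pow (Finset.mem_range_succ_iff.1 hk)
      have : ∑ m ∈ Finset.range (n + 1),
        (n.choose m : ℂ) * (-1) ^ m * (Ring.choose b k * (m * x⁻¹) ^ k) =
        Ring.choose b k * x⁻¹ ^ k *
          ∑ m ∈ Finset.range (n + 1), (n.choose m : ℂ) * (-1) ^ m * (m : ℂ) ^ k := by
        rw [Finset.mul_sum]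
        refine Finset.sum_congr rfl fun m _ => ?_
        rw [mul_pow]
        ring
      rw [this, h]
      split_ifs with hkn
      · rw [hkn]
        ring
      · rw [mul_zero]
    rw [Finset.sum_congr rfl this, Finset.sum_ite_eq' (Finset.range (n + 1)) n,
      if_pos (Finset.self_mem_range_succ n)]
  simp only [hR, mul_sub, Finset.sum_sub_distrib, e1, add_natCast_cpow hx]
  rw [Finset.mul_sum]
  congr 1
  · exact Finset.sum_congr rfl fun m _ => by ring
  · ring

/-- Iterating `Γ(w + 1) = w Γ(w)` yields the falling factorial `(s-1)(s-2)⋯(s-n)`. -/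
theorem Gamma_eq_factorial_mul_choose (n : ℕ) {s : ℂ} (hs : ∀ j : ℤ, s ≠ j) :
    Gamma s = n.factorial * Ring.choose (s - 1) n * Gamma (s - n) := by
  have h : ∀ n : ℕ, Gamma s = (descPochhammer ℂ n).eval (s - 1) * Gamma (s - n) := by
    intro n
    induction n with
    | zero => simp
    | succ n ih =>
      have h0 : s - n - 1 ≠ 0 := by
        intro h
        exact hs (n + 1) (by push_cast; linear_combination h)
      have hG := Gamma_add_one _ h0
      rw [sub_add_cancel] at hG
      rw [ih, hG, descPochhammer_succ_eval, Nat.cast_succ, ← sub_sub]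
      ring
  rw [h n]
  congr 1
  have := Ring.descPochhammer_eq_factorial_smul_choose (s - 1) n
  rw [nsmul_eq_mul] at this
  rw [← this, ← descPochhammer_map (Int.castRingHom ℂ), Polynomial.eval_map,
    ← Polynomial.aeval_eq_smeval]
  rfl

theorem p_isEquivalent (n : ℕ) {s : ℂ} (hs : ∀ k : ℕ, s ≠ n + 1 + k) {δ : ℝ} (hδ : 0 < δ) :
    (fun x : ℂ => p n x s δ) ~[Bornology.cobounded ℂ ⊓ 𝓟 {x : ℂ | 0 < x.re}]
      (fun x : ℂ =>
        (exp (-2 * Real.pi * I * s) - 1) * Gamma (n - s + 1) * x ^ (s - n - 1)) := by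
  have hre : ∀ᶠ x in Bornology.cobounded ℂ ⊓ 𝓟 {x : ℂ | 0 < x.re}, 0 < x.re :=
    mem_inf_of_right (mem_principal_self {x : ℂ | 0 < x.re})
  -- For an integer `s ≤ n` both sides vanish: either `1/Γ(s) = 0`, or `x^{s-1}` is a polynomial of
  -- degree below `n`.
  by_cases hint : ∃ j : ℤ, s = j
  · obtain ⟨j, rfl⟩ := hint
    have hper : exp (-2 * Real.pi * I * j) = 1 := by
      rw [show -2 * (Real.pi : ℂ) * I * j = (-j : ℤ) * (2 * Real.pi * I) by push_cast; ring]
      exact exp_int_mul_two_pi_mul_I _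
    refine EventuallyEq.isEquivalent ?_
    filter_upwards [hre] with x hx
    rw [hper, sub_self, zero_mul, zero_mul, p_eq_sum n hx _ hδ]
    by_cases hj : j ≤ 0
    · obtain ⟨k, hk⟩ := Int.exists_eq_neg_ofNat hj
      have : Gamma (j : ℂ) = 0 := (Gamma_eq_zero_iff _).2 ⟨k, by rw [hk]; push_cast; rfl⟩
      rw [this, div_zero, zero_mul]
    · obtain ⟨k, rfl⟩ : ∃ k : ℕ, j = k + 1 := ⟨(j - 1).toNat, by omega⟩
      have hk : k < n := by
        by_contra hk
        exact hs (k - n) (by rw [Nat.cast_sub (not_lt.1 hk)]; push_cast; ring)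
      have h := sum_choose_mul_eq_fwdDiff n (fun r => r ^ k) x
      rw [fwdDiff_iter_pow_eq_zero_of_lt hk, Pi.zero_apply, mul_zero] at h
      push_cast
      simp only [add_sub_cancel_right, cpow_natCast]
      rw [h, mul_zero]
  · push Not at hint
    have hG0 : Gamma (s - n) ≠ 0 := by
      rw [Ne, Gamma_eq_zero_iff]
      rintro ⟨m, hm⟩
      exact hint (n - m) (by push_cast; linear_combination hm)
    have hG := Gamma_eq_factorial_mul_choose n hint
    have hGs : Gamma s ≠ 0 := by
      rw [Ne, Gamma_eq_zero_iff]
      rintro ⟨m, hm⟩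
      exact hint (-m) (by push_cast; exact hm)
    have hA := exp_sub_one_mul_Gamma (s := s - n)
      (fun k h => hs k (by linear_combination h))
    have hper : exp (-2 * Real.pi * I * (s - n)) = exp (-2 * Real.pi * I * s) := by
      rw [show -2 * (Real.pi : ℂ) * I * (s - n) = -2 * Real.pi * I * s + n * (2 * Real.pi * I) by
        ring, exp_add, exp_nat_mul_two_pi_mul_I, mul_one]
    have hper' : exp (-Real.pi * I * (s - n)) = exp (-Real.pi * I * s) * (-1) ^ n := by
      rw [show -(Real.pi : ℂ) * I * (s - n) = -Real.pi * I * s + n * (Real.pi * I) by ring,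
        exp_add, exp_nat_mul, exp_pi_mul_I]
    rw [hper, hper', show 1 - (s - n) = n - s + 1 by ring] at hA
    set K := -2 * Real.pi * I * exp (-Real.pi * I * s) / Gamma s with hK
    have hA' : (exp (-2 * Real.pi * I * s) - 1) * Gamma (n - s + 1) =
        K * ((-1) ^ n * n.factorial * Ring.choose (s - 1) n) := by
      rw [hA, hK, div_mul_eq_mul_div, div_eq_div_iff hG0 hGs, hG]
      ring
    have hA0 : (exp (-2 * Real.pi * I * s) - 1) * Gamma (n - s + 1) ≠ 0 := by
      rw [hA]
      refine div_ne_zero ?_ hG0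
      have := Real.pi_ne_zero
      simp [exp_ne_zero, I_ne_zero, this]
    refine IsLittleO.isEquivalent ?_
    have h1 := ((sum_choose_mul_cpow_isLittleO n (s - 1)).const_mul_left K).trans_isBigO
      (isBigO_self_const_mul hA0 _ _)
    refine h1.congr' ?_ ?_
    all_goals
      filter_upwards [hre] with x hx
      have hx0 : x ≠ 0 := by
        rintro rfl
        simp at hx
      have hpow : x ^ (s - n - 1) = x ^ (s - 1) * x⁻¹ ^ n := by
        rw [sub_right_comm, cpow_sub _ _ hx0, cpow_natCast, inv_pow, div_eq_mul_inv]
    · rw [Pi.sub_apply, p_eq_sum n hx s hδ, hA', hpow]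
      ring
    · rw [hpow]

/-! ### The substitution `τ = 2πi(a + t)`. -/

theorem loopIntegral_rescale {F G : ℝ → ℝ → ℂ} {c : ℂ} {ρ : ℝ} (hρ : 0 < ρ)
    (hF : ∀ r θ : ℝ, 0 < r → F r θ = c * G (2 * Real.pi * r) (θ + Real.pi / 2)) :
    loopIntegral F (-(Real.pi / 2)) ρ =
      c / (2 * Real.pi * I) * loopIntegral G 0 (2 * Real.pi * ρ) := by
  have hpi : (Real.pi : ℂ) ≠ 0 := ofReal_ne_zero.2 Real.pi_ne_zero
  have hinv : (2 * (Real.pi : ℂ))⁻¹ * -I = 1 / (2 * Real.pi * I) := by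
    field_simp
    rw [I_sq]
    ring
  -- Multiplication by `2πi` scales the modulus by `2π` and shifts the argument by `π/2`, turning
  -- the ray to `-i∞` into the ray to `+∞`; the factor `1/(2πi)` comes from `dτ = 2πi du`.
  have hexp : ∀ θ : ℝ, exp (θ * I) = -I * exp ((θ + Real.pi / 2 : ℝ) * I) := by
    intro θ
    push_cast
    rw [add_mul, exp_add, exp_pi_div_two_mul_I]
    linear_combination exp (θ * I) * I_mul_I
  have hray : ∀ θ : ℝ, ∫ r in Ioi ρ, F r θ * exp (θ * I) = c / (2 * Real.pi * I) *
      ∫ r in Ioi (2 * Real.pi * ρ), G r (θ + Real.pi / 2) *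
        exp ((θ + Real.pi / 2 : ℝ) * I) := by
    intro θ
    have h := integral_comp_mul_left_Ioi
      (fun r => G r (θ + Real.pi / 2) * exp ((θ + Real.pi / 2 : ℝ) * I)) ρ Real.two_pi_pos
    have h' : ∫ r in Ioi ρ, F r θ * exp (θ * I) = (c * -I) * ∫ r in Ioi ρ,
        G (2 * Real.pi * r) (θ + Real.pi / 2) * exp ((θ + Real.pi / 2 : ℝ) * I) := by
      rw [← integral_const_mul]
      refine setIntegral_congr_fun measurableSet_Ioi fun r hr => ?_
      simp only [hF r θ (hρ.trans hr), hexp θ]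
      ring
    rw [h', h, real_smul, ofReal_inv, ofReal_mul, ofReal_ofNat]
    linear_combination (c * ∫ r in Ioi (2 * Real.pi * ρ), G r (θ + Real.pi / 2) *
        exp ((θ + Real.pi / 2 : ℝ) * I)) * hinv
  have hcirc : ∫ θ in (-(Real.pi / 2))..(-(Real.pi / 2) + 2 * Real.pi),
      F ρ θ * (I * (ρ * exp (θ * I))) = c / (2 * Real.pi * I) *
      ∫ θ in (0 : ℝ)..(0 + 2 * Real.pi), G (2 * Real.pi * ρ) θ *
        (I * ((2 * Real.pi * ρ : ℝ) * exp (θ * I))) := by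
    have h := intervalIntegral.integral_comp_add_right (a := -(Real.pi / 2))
      (b := -(Real.pi / 2) + 2 * Real.pi) (fun θ : ℝ => G (2 * Real.pi * ρ) θ *
        (I * ((2 * Real.pi * ρ : ℝ) * exp (θ * I)))) (Real.pi / 2)
    rw [neg_add_cancel, show -(Real.pi / 2) + 2 * Real.pi + Real.pi / 2 = 0 + 2 * Real.pi by ring]
      at h
    rw [← h, ← intervalIntegral.integral_const_mul]
    refine intervalIntegral.integral_congr fun θ _ => ?_
    simp only [hF ρ θ hρ, hexp θ]
    push_cast
    field_simp
    rw [I_sq]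
    ring
  rw [loopIntegral, loopIntegral, hray, hray, hcirc, neg_add_cancel,
    show -(Real.pi / 2) + 2 * Real.pi + Real.pi / 2 = 0 + 2 * Real.pi by ring]
  ring

theorem loopIntegrable_rescale {F G : ℝ → ℝ → ℂ} {c : ℂ} {ρ : ℝ} (hρ : 0 < ρ)
    (hF : ∀ r θ : ℝ, 0 < r → F r θ = c * G (2 * Real.pi * r) (θ + Real.pi / 2))
    (hG : LoopIntegrable G 0 (2 * Real.pi * ρ)) :
    LoopIntegrable F (-(Real.pi / 2)) ρ := by
  have key : ∀ θ : ℝ, IntegrableOn (fun r => G r (θ + Real.pi / 2)) (Ioi (2 * Real.pi * ρ)) →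
      IntegrableOn (fun r => F r θ) (Ioi ρ) := by
    intro θ h
    have h' := (integrableOn_Ioi_comp_mul_left_iff _ ρ Real.two_pi_pos).2 h
    exact IntegrableOn.congr_fun (h'.const_mul c) (fun r hr => (hF r θ (hρ.trans hr)).symm)
      measurableSet_Ioi
  refine ⟨key _ ?_, key _ ?_⟩
  · rw [neg_add_cancel]
    exact hG.1
  · rw [show -(Real.pi / 2) + 2 * Real.pi + Real.pi / 2 = 0 + 2 * Real.pi by ring]
    exact hG.2

theorem branchIntegrand_eq {z : ℂ} (hz : z ≠ 0) (s a : ℂ) {r : ℝ} (hr : 0 < r) (θ : ℝ) :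
    branchIntegrand z s a r θ =
      (2 * Real.pi * I * exp (Real.pi * I * a) * (-z) ^ (-a) * (2 * Real.pi * I) ^ s) *
        laplaceKernel (fun τ => (exp (2 * Real.pi * I * a) * exp (-τ) - 1)⁻¹)
          (1 / 2 - log (-z) / (2 * Real.pi * I)) s (2 * Real.pi * r) (θ + Real.pi / 2) := by
  have hpi : (Real.pi : ℂ) ≠ 0 := ofReal_ne_zero.2 Real.pi_ne_zero
  set L := log (-z) with hL
  set u : ℂ := r * exp (θ * I) with hu
  have hτ : ((2 * Real.pi * r : ℝ) : ℂ) * exp ((θ + Real.pi / 2 : ℝ) * I) =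
      2 * Real.pi * I * u := by
    push_cast
    rw [add_mul, exp_add, exp_pi_div_two_mul_I, hu]
    ring
  have hx : exp (-(1 / 2 - L / (2 * Real.pi * I)) * (2 * Real.pi * I * u)) =
      exp (-(Real.pi * I * u)) * exp (L * u) := by
    rw [← exp_add]
    congr 1
    field_simp
    ring
  have hz' : (-z) ^ (-a + u) = (-z) ^ (-a) * exp (L * u) := by
    rw [cpow_add _ _ (neg_ne_zero.2 hz), cpow_def_of_ne_zero (neg_ne_zero.2 hz) u]
  -- The principal argument of `2πi` is `π/2`, exactly the shift of `θ`, so no extra factor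
  -- `e^{2πis}` appears.
  have hbr : (branchPow r θ s)⁻¹ =
      (2 * Real.pi * I) ^ s * branchPow (2 * Real.pi * r) (θ + Real.pi / 2) (-s) := by
    have hlog : log (2 * Real.pi * I) = Real.log (2 * Real.pi) + Real.pi / 2 * I := by
      have := log_ofReal_mul Real.two_pi_pos I_ne_zero
      rw [log_I] at this
      rw [← this]
      push_cast
      rfl
    rw [cpow_def_of_ne_zero (by simp [hpi, I_ne_zero]), hlog, branchPow, branchPow, ← exp_neg,
      ← exp_add, Real.log_mul Real.two_pi_pos.ne' hr.ne']
    congr 1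
    push_cast
    ring
  have hsin : Gamma (1 + (-a + u)) * Gamma (-(-a + u)) =
      2 * Real.pi * I * exp (Real.pi * I * a) * exp (-(Real.pi * I * u)) *
        (exp (2 * Real.pi * I * a) * exp (-(2 * Real.pi * I * u)) - 1)⁻¹ := by
    have h := Complex.Gamma_mul_Gamma_one_sub (-(-a + u))
    rw [sub_neg_eq_add] at h
    rw [mul_comm, h, sin]
    have e1 : exp (-(Real.pi * -(-a + u)) * I) = exp (-(Real.pi * I * a)) * exp (Real.pi * I * u) :=
      by
        rw [← exp_add]
        congr 1
        ring
    have e2 : exp (Real.pi * -(-a + u) * I) = exp (Real.pi * I * a) * exp (-(Real.pi * I * u)) := by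
        rw [← exp_add]
        congr 1
        ring
    have e3 : exp (2 * Real.pi * I * a) = exp (Real.pi * I * a) * exp (Real.pi * I * a) := by
        rw [← exp_add]
        congr 1
        ring
    have e4 : exp (-(2 * Real.pi * I * u)) =
        exp (-(Real.pi * I * u)) * exp (-(Real.pi * I * u)) := by
        rw [← exp_add]
        congr 1
        ring
    rw [e1, e2, e3, e4, exp_neg, exp_neg]
    have hA := exp_ne_zero (Real.pi * I * a)
    have hU := exp_ne_zero (Real.pi * I * u)
    set A := exp (Real.pi * I * a)
    set U := exp (Real.pi * I * u)
    have f1 : (A⁻¹ * U - A * U⁻¹) * I / 2 = -(I * U / (2 * A)) * (A * A * (U⁻¹ * U⁻¹) - 1) := by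
      field_simp
      ring
    rw [f1, div_eq_mul_inv, mul_inv, inv_neg, inv_div]
    field_simp
    rw [I_sq]
    ring
  simp only [branchIntegrand, laplaceKernel]
  rw [hτ, hx, div_eq_mul_inv, hbr, hsin, hz']
  ring

/-! ### Poles and bounds of `1 / (q e^{-τ} - 1)`. -/

theorem exists_int_of_exp_mul_exp_neg_eq_one {a τ : ℂ}
    (h : exp (2 * Real.pi * I * a) * exp (-τ) = 1) :
    ∃ m : ℤ, τ = 2 * Real.pi * I * (a + m) := by
  rw [← exp_add, exp_eq_one_iff] at h
  obtain ⟨n, hn⟩ := h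
  exact ⟨-n, by push_cast; linear_combination -hn⟩

/-- The ray `τ > 0` is the image of the half-line below `t = -a`, and the poles are the images of
the integers. -/
theorem exp_mul_exp_neg_ne_one_of_pos {a : ℂ} (ha : 0 < a.im ∨ ∀ m : ℤ, a.re ≠ m) {r : ℝ}
    (hr : 0 < r) : exp (2 * Real.pi * I * a) * exp (-(r : ℂ)) - 1 ≠ 0 := by
  intro h
  obtain ⟨m, hm⟩ := exists_int_of_exp_mul_exp_neg_eq_one (sub_eq_zero.1 h)
  have hre := congrArg re hm
  have him := congrArg im hm
  simp only [ofReal_re, ofReal_im, mul_re, mul_im, add_re, add_im, I_re, I_im, intCast_re,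
    intCast_im, re_ofNat, im_ofNat] at hre him
  ring_nf at hre him
  have hpi := Real.pi_pos
  rcases ha with ha | ha
  · nlinarith
  · refine ha (-m) ?_
    have : Real.pi * (a.re + m) = 0 := by linarith
    rcases mul_eq_zero.1 this with h | h
    · exact absurd h hpi.ne'
    · push_cast
      linarith

theorem exp_mul_exp_neg_ne_one_of_norm_le {a : ℂ} {ρ : ℝ} (ha : ∀ m : ℤ, ρ < ‖a + m‖) {τ : ℂ}
    (hτ : ‖τ‖ ≤ 2 * Real.pi * ρ) : exp (2 * Real.pi * I * a) * exp (-τ) - 1 ≠ 0 := by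
  intro h
  obtain ⟨m, hm⟩ := exists_int_of_exp_mul_exp_neg_eq_one (sub_eq_zero.1 h)
  rw [hm] at hτ
  have h2 := Real.two_pi_pos
  have : ‖2 * (Real.pi : ℂ) * I‖ = 2 * Real.pi := by
    rw [norm_mul, norm_mul, norm_I, norm_real, Real.norm_of_nonneg Real.pi_pos.le]
    simp
  rw [norm_mul, this] at hτ
  have := le_of_mul_le_mul_left hτ h2
  exact absurd this (not_le.2 (ha m))

theorem exists_bound_ray {q : ℂ} {δ : ℝ} (h : ∀ r : ℝ, δ ≤ r → q * exp (-(r : ℂ)) - 1 ≠ 0) :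
    ∃ M : ℝ, ∀ r : ℝ, δ ≤ r → ‖(q * exp (-(r : ℂ)) - 1)⁻¹‖ ≤ M := by
  have hcont : Continuous fun r : ℝ => q * exp (-(r : ℂ)) := by fun_prop
  have hlim : Tendsto (fun r : ℝ => q * exp (-(r : ℂ))) atTop (𝓝 0) := by
    rw [tendsto_zero_iff_norm_tendsto_zero]
    have : Tendsto (fun r : ℝ => ‖q‖ * Real.exp (-r)) atTop (𝓝 (‖q‖ * 0)) :=
      (Real.tendsto_exp_neg_atTop_nhds_zero).const_mul _
    rw [mul_zero] at this
    refine this.congr fun r => ?_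
    rw [norm_mul, norm_exp, neg_re, ofReal_re]
  -- Beyond `T` the denominator has modulus at least `1/2`; compactness covers the rest.
  have hev := (hlim.norm).eventually_lt_const (u := 1 / 2) (by simp)
  obtain ⟨T, hT⟩ := eventually_atTop.1 hev
  obtain ⟨M, hM⟩ := (isCompact_Icc (a := δ) (b := T)).exists_bound_of_continuousOn
    (f := fun r : ℝ => (q * exp (-(r : ℂ)) - 1)⁻¹)
    (fun r hr => ((hcont.sub continuous_const).continuousAt.inv₀ (h r hr.1)).continuousWithinAt)
  refine ⟨max M 2, fun r hr => ?_⟩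
  rcases le_total r T with hrT | hrT
  · exact (hM r ⟨hr, hrT⟩).trans (le_max_left _ _)
  · refine le_trans ?_ (le_max_right _ _)
    have h1 := hT r hrT
    have h2 : 1 / 2 ≤ ‖q * exp (-(r : ℂ)) - 1‖ := by
      have := norm_sub_norm_le (1 : ℂ) (q * exp (-(r : ℂ)))
      rw [norm_one, norm_sub_rev] at this
      linarith
    rw [norm_inv]
    calc _ ≤ (1 / 2 : ℝ)⁻¹ := inv_anti₀ (by norm_num) h2
      _ = 2 := by norm_num

/-! ### Termwise integration of the geometric series. -/

theorem tendsto_loopIntegral_laplaceKernel {g : ℕ → ℂ → ℂ} {h : ℂ → ℂ} {x s : ℂ} {δ M : ℝ}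
    (hδ : 0 < δ) (hx : 0 < x.re)
    (hg : ∀ N, Continuous (g N))
    (hcirc : ∀ τ : ℂ, ‖τ‖ = δ → (∀ N, ‖g N τ‖ ≤ M) ∧ Tendsto (fun N => g N τ) atTop (𝓝 (h τ)))
    (hray : exp (-2 * Real.pi * I * s) = 1 ∨ ∀ r : ℝ, δ < r →
      (∀ N, ‖g N r‖ ≤ M) ∧ Tendsto (fun N => g N r) atTop (𝓝 (h r))) :
    Tendsto (fun N => loopIntegral (laplaceKernel (g N) x s) 0 δ) atTop
      (𝓝 (loopIntegral (laplaceKernel h x s) 0 δ)) := by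
  simp only [loopIntegral_laplaceKernel _ x s hδ]
  refine Tendsto.add ?_ ?_
  · rcases hray with hs | hray
    · simp only [hs, sub_self, zero_mul]
      exact tendsto_const_nhds
    · refine Tendsto.const_mul _ ?_
      refine tendsto_integral_of_dominated_convergence
        (fun r => Real.exp (-x.re * r) * r ^ (-s.re) * M) (fun N => ?_)
        ((integrableOn_exp_mul_rpow hx (-s.re) hδ).mul_const M) (fun N => ?_) ?_
      · exact (continuousOn_rayIntegrand x s (fun r hr => hδ.trans hr)
          fun r _ => (hg N).continuousAt).aestronglyMeasurable measurableSet_Ioi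
      · filter_upwards [ae_restrict_mem measurableSet_Ioi] with r hr
        have hr0 : 0 < r := hδ.trans hr
        rw [norm_rayIntegrand _ x s hr0]
        exact mul_le_mul_of_nonneg_left ((hray r hr).1 N) (by positivity)
      · filter_upwards [ae_restrict_mem measurableSet_Ioi] with r hr
        exact (hray r hr).2.const_mul _
  · have hn : ∀ θ : ℝ, ‖(δ : ℂ) * exp (θ * I)‖ = δ := fun θ => by
      rw [norm_mul, norm_exp_ofReal_mul_I, mul_one, norm_real, Real.norm_of_nonneg hδ.le]
    refine intervalIntegral.tendsto_integral_filter_of_dominated_convergence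
      (fun _ => Real.exp (‖x‖ * δ) * (δ ^ (-s.re) * Real.exp (2 * Real.pi * |s.im|)) * M * δ)
      (Eventually.of_forall fun N => ?_) (Eventually.of_forall fun N => ?_)
      intervalIntegrable_const ?_
    · exact (continuous_laplaceKernel_circle x s hδ
        fun _ _ => (hg N).continuousAt).aestronglyMeasurable
    · refine Eventually.of_forall fun θ hθ => ?_
      rw [uIoc_of_le Real.two_pi_pos.le] at hθ
      rw [norm_mul, norm_mul, norm_I, one_mul, hn]
      refine mul_le_mul_of_nonneg_right ((norm_laplaceKernel_le _ x s hδ ⟨hθ.1.le, hθ.2⟩).trans ?_)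
        hδ.le
      exact mul_le_mul_of_nonneg_left ((hcirc _ (hn θ)).1 N) (by positivity)
    · refine Eventually.of_forall fun θ _ => ?_
      exact ((hcirc _ (hn θ)).2.const_mul _).mul_const _

/-- The partial sums of the geometric expansion of `1 / (q e^{-τ} - 1)` in powers of
`1 - e^{-τ}`. -/
theorem geom_partialSum_eq {q v : ℂ} (hq : q - 1 ≠ 0) (hv : q * (1 - v) - 1 ≠ 0) (N : ℕ) :
    ∑ n ∈ Finset.range N, q ^ n / (q - 1) ^ (n + 1) * v ^ n =
      (1 - (q * v / (q - 1)) ^ N) * (q * (1 - v) - 1)⁻¹ := by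
  have hw : q * v / (q - 1) ≠ 1 := by
    intro h
    rw [div_eq_one_iff_eq hq] at h
    exact hv (by linear_combination -h)
  have h1 : ∀ n : ℕ, q ^ n / (q - 1) ^ (n + 1) * v ^ n =
      (q - 1)⁻¹ * (q * v / (q - 1)) ^ n := by
    intro n
    rw [div_pow, mul_pow, pow_succ]
    field_simp
  have h2 : q * v / (q - 1) - 1 = -(q * (1 - v) - 1) / (q - 1) := by
    field_simp
    ring
  simp only [h1]
  rw [← Finset.mul_sum, geom_sum_eq hw, h2]
  field_simp
  ring

/-- The `N`-th partial sum is `1 - w^N` times the limit, `w` being the ratio. Hence the bound `2 *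
M` does not deteriorate as `|w|` approaches `1`. -/
theorem geom_partialSum_bound_tendsto {q v : ℂ} (hq : q - 1 ≠ 0) (hv : q * (1 - v) - 1 ≠ 0)
    (hlt : ‖q * v / (q - 1)‖ < 1) {M : ℝ} (hM : ‖(q * (1 - v) - 1)⁻¹‖ ≤ M) :
    (∀ N : ℕ, ‖∑ n ∈ Finset.range N, q ^ n / (q - 1) ^ (n + 1) * v ^ n‖ ≤ 2 * M) ∧
      Tendsto (fun N : ℕ => ∑ n ∈ Finset.range N, q ^ n / (q - 1) ^ (n + 1) * v ^ n) atTop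
        (𝓝 (q * (1 - v) - 1)⁻¹) := by
  simp only [geom_partialSum_eq hq hv]
  constructor
  · intro N
    rw [norm_mul]
    refine mul_le_mul ?_ hM (norm_nonneg _) (by norm_num)
    calc _ ≤ ‖(1 : ℂ)‖ + ‖(q * v / (q - 1)) ^ N‖ := norm_sub_le _ _
      _ ≤ 1 + 1 := by
        rw [norm_one, norm_pow]
        gcongr
        exact pow_le_one₀ (norm_nonneg _) hlt.le
      _ = 2 := by norm_num
  · have := ((tendsto_pow_atTop_nhds_zero_of_norm_lt_one hlt).const_sub 1).mul_const
      (q * (1 - v) - 1)⁻¹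
    simpa using this

theorem branchContribution_expansion {s a z : ℂ} {δ ρ : ℝ} (hδ : 0 < δ) (hz : -z ∈ slitPlane)
    (ha : 0 < a.im ∨ ∀ m : ℤ, a.re ≠ m)
    (hconv : (∃ k : ℤ, s = k) ∨
      ‖exp (2 * Real.pi * I * a)‖ ≤ ‖exp (2 * Real.pi * I * a) - 1‖)
    (hρ : 0 < ρ) (hρa : ∀ m : ℤ, ρ < ‖a + m‖) :
    LoopIntegrable (branchIntegrand z s a) (-(Real.pi / 2)) ρ ∧
    Tendsto (fun N : ℕ => exp (Real.pi * I * a) * (2 * Real.pi * I) ^ (s - 1) / (-z) ^ a *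
        ∑ n ∈ Finset.range N,
          exp (2 * Real.pi * I * a * n) / (exp (2 * Real.pi * I * a) - 1) ^ (n + 1) *
            p n (1 / 2 - log (-z) / (2 * Real.pi * I)) s δ)
      atTop (𝓝 (branchContribution z s a ρ)) := by
  have hpi := Real.pi_pos
  have hpiC : (Real.pi : ℂ) ≠ 0 := ofReal_ne_zero.2 Real.pi_ne_zero
  have hz0 : z ≠ 0 := neg_ne_zero.1 (slitPlane_ne_zero hz)
  have hR : 0 < 2 * Real.pi * ρ := mul_pos Real.two_pi_pos hρ
  set x : ℂ := 1 / 2 - log (-z) / (2 * Real.pi * I) with hx_def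
  have hx : 0 < x.re := by
    -- Here `Re x = 1/2 - arg(-z)/(2π)`, positive because `arg(-z) < π` off the cut.
    have h1 : x = 1 / 2 + log (-z) * I / ((2 * Real.pi : ℝ) : ℂ) := by
      rw [hx_def]
      push_cast
      field_simp
      linear_combination (-log (-z)) * I_mul_I
    have h2 : x.re = 1 / 2 - (-z).arg / (2 * Real.pi) := by
      rw [h1, add_re, div_ofReal_re, mul_I_re, log_im]
      norm_num
      ring
    have h3 : (-z).arg < Real.pi := lt_of_le_of_ne (arg_le_pi _) (slitPlane_arg_ne_pi hz)
    rw [h2, sub_pos, div_lt_div_iff₀ Real.two_pi_pos two_pos]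
    linarith
  set q : ℂ := exp (2 * Real.pi * I * a) with hq_def
  set h : ℂ → ℂ := fun τ => (q * exp (-τ) - 1)⁻¹ with h_def
  have hq : q - 1 ≠ 0 := by
    have := exp_mul_exp_neg_ne_one_of_norm_le hρa (τ := 0) (by rw [norm_zero]; exact hR.le)
    simpa using this
  have hnz : ∀ τ : ℂ, ‖τ‖ ≤ 2 * Real.pi * ρ → q * exp (-τ) - 1 ≠ 0 :=
    fun τ hτ => exp_mul_exp_neg_ne_one_of_norm_le hρa hτ
  have hnzr : ∀ r : ℝ, 0 < r → q * exp (-(r : ℂ)) - 1 ≠ 0 :=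
    fun r hr => exp_mul_exp_neg_ne_one_of_pos ha hr
  -- Both loops, of radii `δ` and `2πρ`, are moved to a common circle on which the ratio has modulus
  -- below `1`.
  obtain ⟨ε, hε, hεδ, hερ, hεw⟩ : ∃ ε : ℝ, 0 < ε ∧ ε ≤ δ ∧ ε ≤ 2 * Real.pi * ρ ∧
      ∀ τ : ℂ, ‖τ‖ ≤ ε → ‖q * (1 - exp (-τ)) / (q - 1)‖ < 1 := by
    have hc : ContinuousAt (fun τ : ℂ => ‖q * (1 - exp (-τ)) / (q - 1)‖) 0 := by fun_prop
    have hev := hc.tendsto.eventually_lt_const (u := 1) (by simp)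
    obtain ⟨ε, hε, hball⟩ := Metric.eventually_nhds_iff.1 hev
    refine ⟨min (ε / 2) (min δ (2 * Real.pi * ρ)), by positivity,
      (min_le_right _ _).trans (min_le_left _ _), (min_le_right _ _).trans (min_le_right _ _),
      fun τ hτ => hball ?_⟩
    rw [dist_zero_right]
    have := hτ.trans (min_le_left _ _)
    linarith
  obtain ⟨M₁, hM₁⟩ := exists_bound_ray (q := q) (δ := ε) fun r hr => hnzr r (hε.trans_le hr)
  obtain ⟨M₂, hM₂⟩ := (isCompact_sphere (0 : ℂ) ε).exists_bound_of_continuousOn (f := h)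
    (fun τ hτ => by
      have : q * exp (-τ) - 1 ≠ 0 := hnz τ (by rw [mem_sphere_zero_iff_norm.1 hτ]; exact hερ)
      exact ContinuousAt.continuousWithinAt
        (ContinuousAt.inv₀ (f := fun τ => q * exp (-τ) - 1) (by fun_prop) this))
  have hint : IntegrableOn (rayIntegrand h x s) (Ioi ε) :=
    integrableOn_rayIntegrand hε hx
      (fun r hr => ContinuousAt.inv₀ (f := fun τ => q * exp (-τ) - 1) (by fun_prop)
        (hnzr r (hε.trans hr))) (fun r hr => hM₁ r hr.le)
  have hloop : loopIntegral (laplaceKernel h x s) 0 ε =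
      loopIntegral (laplaceKernel h x s) 0 (2 * Real.pi * ρ) := by
    refine loopIntegral_laplaceKernel_eq hε hερ (fun τ _ hτ => ?_) hint
    exact DifferentiableAt.inv (h := fun τ => q * exp (-τ) - 1) (by fun_prop) (hnz τ hτ)
  refine ⟨loopIntegrable_rescale hρ (fun r θ hr => branchIntegrand_eq hz0 s a hr θ)
    (loopIntegrable_laplaceKernel hR (hint.mono_set (Ioi_subset_Ioi hερ))), ?_⟩
  have hB : branchContribution z s a ρ =
      exp (Real.pi * I * a) * (2 * Real.pi * I) ^ (s - 1) / (-z) ^ a *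
        loopIntegral (laplaceKernel h x s) 0 ε := by
    have hresc : loopIntegral (branchIntegrand z s a) (-(Real.pi / 2)) ρ = _ *
        loopIntegral (laplaceKernel h x s) 0 (2 * Real.pi * ρ) :=
      loopIntegral_rescale hρ (fun r θ hr => branchIntegrand_eq hz0 s a hr θ)
    rw [branchContribution, hresc, hloop, cpow_sub _ _ (by simp [hpiC, I_ne_zero]), cpow_one,
      cpow_neg]
    generalize loopIntegral (laplaceKernel h x s) 0 (2 * Real.pi * ρ) = J
    field_simp
  rw [hB]
  refine Tendsto.const_mul _ ?_
  have hsum : ∀ N : ℕ, ∑ n ∈ Finset.range N,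
      exp (2 * Real.pi * I * a * n) / (q - 1) ^ (n + 1) * p n x s δ =
      loopIntegral (laplaceKernel (fun τ => ∑ n ∈ Finset.range N,
        q ^ n / (q - 1) ^ (n + 1) * (1 - exp (-τ)) ^ n) x s) 0 ε := by
    intro N
    have hF : laplaceKernel (fun τ => ∑ n ∈ Finset.range N,
        q ^ n / (q - 1) ^ (n + 1) * (1 - exp (-τ)) ^ n) x s = fun r θ =>
        ∑ n ∈ Finset.range N, (q ^ n / (q - 1) ^ (n + 1)) *
          laplaceKernel (fun τ => (1 - exp (-τ)) ^ n) x s r θ := by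
      funext r θ
      simp only [laplaceKernel, Finset.mul_sum]
      exact Finset.sum_congr rfl fun n _ => by ring
    rw [hF, loopIntegral_sum _ (fun n => q ^ n / (q - 1) ^ (n + 1))
      (F := fun n => laplaceKernel (fun τ => (1 - exp (-τ)) ^ n) x s)
      (fun n _ => loopIntegrable_laplaceKernel hε (integrableOn_rayIntegrand_pow n hx s hε))
      (fun n _ => (continuous_laplaceKernel_circle _ s hε
        fun _ _ => by fun_prop).intervalIntegrable _ _)]
    refine Finset.sum_congr rfl fun n _ => ?_
    rw [p, pIntegrand_eq_laplaceKernel, ← loopIntegral_laplaceKernel_eq hε hεδ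
      (fun τ _ _ => by fun_prop) (integrableOn_rayIntegrand_pow n hx s hε), hq_def, ← exp_nat_mul,
      mul_comm (n : ℂ)]
  simp only [hsum]
  refine tendsto_loopIntegral_laplaceKernel (M := 2 * max M₁ M₂) hε hx (fun N => by fun_prop) ?_ ?_
  · intro τ hτ
    have := geom_partialSum_bound_tendsto (v := 1 - exp (-τ)) (M := max M₁ M₂) hq
      (by rw [sub_sub_cancel]; exact hnz τ (hτ.le.trans hερ)) (hεw τ hτ.le) (by
        rw [sub_sub_cancel]
        exact (hM₂ τ (mem_sphere_zero_iff_norm.2 hτ)).trans (le_max_right _ _))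
    rw [sub_sub_cancel] at this
    exact this
  · rcases hconv with ⟨k, rfl⟩ | hconv
    · left
      rw [show -2 * (Real.pi : ℂ) * I * k = (-k : ℤ) * (2 * Real.pi * I) by push_cast; ring]
      exact exp_int_mul_two_pi_mul_I _
    · right
      intro r hr
      have hr0 : 0 < r := hε.trans hr
      -- The strict inequality `1 - e^{-r} < 1` makes this work even when `‖q‖ = ‖q - 1‖`.
      have hlt : ‖q * (1 - exp (-(r : ℂ))) / (q - 1)‖ < 1 := by
        have h1 : (1 : ℂ) - exp (-r) = ((1 - Real.exp (-r) : ℝ) : ℂ) := by push_cast; rfl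
        have h2 : Real.exp (-r) < 1 := by
          rw [← Real.exp_zero]
          exact Real.exp_lt_exp.2 (by linarith)
        have h3 := Real.exp_pos (-r)
        have hq0 : 0 < ‖q‖ := norm_pos_iff.2 (exp_ne_zero _)
        rw [norm_div, norm_mul, h1, norm_real, Real.norm_of_nonneg (by linarith),
          div_lt_one (norm_pos_iff.2 hq)]
        nlinarith
      have := geom_partialSum_bound_tendsto (v := 1 - exp (-(r : ℂ))) (M := max M₁ M₂) hq
        (by rw [sub_sub_cancel]; exact hnzr r hr0) hlt (by
          rw [sub_sub_cancel]
          exact (hM₁ r hr.le).trans (le_max_left _ _))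
      rw [sub_sub_cancel] at this
      exact this

end

end Lerch

theorem mainTheorem3 (s : ℂ) (δ : ℝ) (hδ : 0 < δ) :
    -- the convergent expansion of the branch-point contribution
    (∀ (a z : ℂ) (ρ : ℝ),
      -- `z` is not in `[0, ∞)`
      -z ∈ slitPlane →
      -- no integer lies on the half-line from `-a` to `-a - i∞`
      (0 < a.im ∨ ∀ m : ℤ, a.re ≠ m) →
      -- the convergence condition; it is void if `s` is an integer
      ((∃ k : ℤ, s = k) ∨
        ‖exp (2 * Real.pi * I * a)‖ ≤ ‖exp (2 * Real.pi * I * a) - 1‖) →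
      -- no integer lies in the closed disc of radius `ρ` about `-a`
      0 < ρ → (∀ m : ℤ, ρ < ‖a + m‖) →
      Lerch.LoopIntegrable (Lerch.branchIntegrand z s a) (-(Real.pi / 2)) ρ ∧
      Tendsto
        (fun N : ℕ =>
          exp (Real.pi * I * a) * (2 * Real.pi * I) ^ (s - 1) / (-z) ^ a *
            ∑ n ∈ Finset.range N,
              exp (2 * Real.pi * I * a * n) / (exp (2 * Real.pi * I * a) - 1) ^ (n + 1) *
                Lerch.p n (1 / 2 - log (-z) / (2 * Real.pi * I)) s δ)
        atTop (𝓝 (Lerch.branchContribution z s a ρ))) ∧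
    -- the loop integrals converge and are finite binomial sums
    (∀ (n : ℕ) (x : ℂ), 0 < x.re →
      Lerch.LoopIntegrable (Lerch.pIntegrand n x s) 0 δ ∧
      Lerch.p n x s δ =
        -2 * Real.pi * I * exp (-Real.pi * I * s) / Gamma s *
          ∑ m ∈ Finset.range (n + 1), (n.choose m : ℂ) * (-1) ^ m * (x + m) ^ (s - 1)) ∧
    -- the behaviour as `x → ∞` in the half-plane `Re x > 0`, unless `Γ(n - s + 1)` is infinite
    (∀ n : ℕ, (∀ k : ℕ, s ≠ n + 1 + k) →
      (fun x : ℂ => Lerch.p n x s δ) ~[Bornology.cobounded ℂ ⊓ 𝓟 {x : ℂ | 0 < x.re}]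
        (fun x : ℂ =>
          (exp (-2 * Real.pi * I * s) - 1) * Gamma (n - s + 1) * x ^ (s - n - 1))) := by
  refine ⟨fun a z ρ hz ha hconv hρ hρa =>
      Lerch.branchContribution_expansion hδ hz ha hconv hρ hρa, fun n x hx =>
      ⟨?_, Lerch.p_eq_sum n hx s hδ⟩, fun n hs => Lerch.p_isEquivalent n hs hδ⟩
  exact Lerch.loopIntegrable_laplaceKernel hδ (Lerch.integrableOn_rayIntegrand_pow n hx s hδ)
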